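/- Let $A$ be a nonempty finite set. A *partition* of $A$ is a set $P$ of pairwise disjoint subsets of $A$ (the empty set is allowed as a member) with union $A$. A partition $P$ is *coarser* than $Q$ if every member of $P$ is a union of one or more members of $Q$; $P\vee Q$ denotes the finest common coarsening. A *scenario* on $A$ is a pair $(\mathcal P,\mathcal S)$ of a set $\mathcal P$ of partitions of $A$ and a set $\mathcal S\subseteq 2^A$ such that (SC1) $\mathcal P$ is closed under coarser partitions, (SC2) if $X\subseteq S\in\mathcal S$ and $X\in P\in\mathcal P$, then $X\in\mathcal S$, and (SC3) $\{S,S^c\}\in\mathcal P$ for every $S\in\mathcal S$. It is *weakly submodular* if for all $P,Q\in\mathcal P$, $X\in P$, $Y\in Q$ with $A\setminus(X\cup Y)\neq\emptyset$ there is a nonempty $F\subseteq A\setminus(X\cup Y)$ with $P_{X\to F}\in\mathcal P$ or $Q_{Y\to F}\in\mathcal P$, where $P_{X\to F}$ arises from $P$ by replacing $X$ by $X\cup F$ and every other member $Z$ by $Z\setminus F$. *Game.* In the captain and robber game on $(\mathcal P,\mathcal S)$ the captain starts with $\{A\}$ (she loses if $\{A\}\notin\mathcal P$) and the robber chooses any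 $r\in A$. In position $(P,r)$ with $r\in X\in P$ the captain chooses $P'\in\mathcal P$; knowing $P'$, the robber moves to some $r'\in Y$, where $X\subseteq Y\in P\vee P'$. If $r'\in X'\in P'$ with $X'\in\mathcal S$, the captain wins, otherwise play continues from $(P',r')$; infinite plays are won by the robber. In the monotone game the captain may only choose $P'$ such that $X$ is a union of members of $P'$. The scenario is *monotone* if the captain has a winning strategy in the game if and only if she has one in the monotone game. *Trees.* Trees are finite; leaves are the nodes of degree at most one, the other nodes are internal. A *tree decomposition* of $(\mathcal P,\mathcal S)$ is a tree $T$ with a map $\tau$ from its leaves to $\mathcal S$ whose image is a partition of $A$, such that for every internal node $t$ the set $P_t=\{\bigcup_{v\text{ leaf in }C}\tau(v) : C\text{ a component of }T\setminus t\}$ lies in $\mathcal P$. An *exact search tree* for $(\mathcal P,\mathcal S)$ is a tree $T$ with at least one edge and a label $l(s,t)\subseteq A$ for each ordered pair of adjacent nodes, such that for every internal node $t$ the set $\{l(t,u) : u\text{ adjacent to }t\}$ is a partition of $A$ belonging to $\mathcal P$, $l(s,t)\cap l(t,s)=\emptyset$ and $l(s,t)\cup l(t,s)=A$ for all adjacent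 $s,t$, and $l(s,t)\in\mathcal S$ whenever $t$ is a leaf. A *bramble* for $\mathcal P$ is a nonempty set $\mathcal B$ of nonempty, pairwise intersecting subsets of $A$ with $P\cap\mathcal B\neq\emptyset$ for every $P\in\mathcal P$; it *avoids* $\mathcal S$ if $\mathcal B\cap\mathcal S=\emptyset$. **Theorem.** Let $f\colon 2^A\to\mathbb Z$ be a connectivity function, i.e. $f(X)=f(A\setminus X)$ and $f(X)+f(Y)\ge f(X\cup Y)+f(X\cap Y)$ for all $X,Y\subseteq A$, with $f(\emptyset)\geq 0$. Let $\mathcal S\subseteq 2^A$ be closed under subsets, and let $k$ be an integer with $k\ge f(S)+f(A\setminus S)=2f(S)$ for all $S\in\mathcal S$. Let $\mathrm{Part}_f^k$ be the set of all partitions $P$ of $A$ with $\sum_{X\in P}f(X)\le k$. Then: 1. $(\mathrm{Part}_f^k,\mathcal S)$ is a weakly submodular scenario on $A$. 2. If $\bigcup\mathcal S=A$, then the following are equivalent: (a) $(\mathrm{Part}_f^k,\mathcal S)$ has an exact search tree; (b) $(\mathrm{Part}_f^k,\mathcal S)$ has a tree decomposition; (c) the captain has a winning strategy in the monotone captain and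 robber game on $(\mathrm{Part}_f^k,\mathcal S)$; (d) the captain has a winning strategy in the captain and robber game on $(\mathrm{Part}_f^k,\mathcal S)$; (e) $\mathrm{Part}_f^k$ has no bramble avoiding $\mathcal S$. 3. The scenario $(\mathrm{Part}_f^k,\mathcal S)$ is monotone. -/

import Mathlib

/-! Scenarios on a finite ground set `A`, represented by a finite type `α`: subsets of `A` are
terms of `Finset α`, complements are taken in `α`, and `A` itself is `Finset.univ`. -/

namespace CaptainRobber

section Partitions

variable {α : Type*} [Fintype α] [DecidableEq α]

/-- A partition of the ground set; the empty set is allowed as a member. -/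
structure IsPartition (P : Finset (Finset α)) : Prop where
  disjoint : ∀ X ∈ P, ∀ Y ∈ P, X ≠ Y → Disjoint X Y
  cover : ∀ a : α, ∃ X ∈ P, a ∈ X

/-- `X` is a union `B₁ ∪ … ∪ Bₙ`, with `n ≥ 1`, of members of `P`. -/
def IsUnionOf (X : Finset α) (P : Finset (Finset α)) : Prop :=
  ∃ C ⊆ P, C.Nonempty ∧ C.sup id = X

/-- `P` is coarser than `Q`: every member of `P` is a union of members of `Q`. -/
def IsCoarser (P Q : Finset (Finset α)) : Prop :=
  ∀ X ∈ P, IsUnionOf X Q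

open Classical in
/-- The common coarsening `P ∨ Q`: the partition into the sets that are both a union of members
of `P` and a union of members of `Q`, and that do not split further into such sets. -/
noncomputable def commonCoarsening (P Q : Finset (Finset α)) : Finset (Finset α) :=
  Finset.univ.filter fun X =>
    IsUnionOf X P ∧ IsUnionOf X Q ∧
      ∀ Z ⊆ X, Z.Nonempty → IsUnionOf Z P → IsUnionOf Z Q → Z = X

/-- `P_{X → F}`: the member `X` is replaced by `X ∪ F`, every other member loses `F`. -/
def shift (P : Finset (Finset α)) (X F : Finset α) : Finset (Finset α) :=
  insert (X ∪ F) ((P.erase X).image fun Z => Z \ F)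

/-- Weak submodularity of a set `𝒬` of partitions. -/
def WeaklySubmodular (𝒬 : Set (Finset (Finset α))) : Prop :=
  ∀ P ∈ 𝒬, ∀ Q ∈ 𝒬, ∀ X ∈ P, ∀ Y ∈ Q, ((X ∪ Y)ᶜ).Nonempty →
    ∃ F : Finset α, F.Nonempty ∧ F ⊆ (X ∪ Y)ᶜ ∧ (shift P X F ∈ 𝒬 ∨ shift Q Y F ∈ 𝒬)

/-- A scenario `(𝒬, 𝒮)`: a set of partitions and a set of subsets of the ground set satisfying
(SC1), (SC2) and (SC3). -/
structure IsScenario (𝒬 : Set (Finset (Finset α))) (𝒮 : Set (Finset α)) : Prop where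
  isPartition : ∀ P ∈ 𝒬, IsPartition P
  sc1 : ∀ Q ∈ 𝒬, ∀ P, IsPartition P → IsCoarser P Q → P ∈ 𝒬
  sc2 : ∀ S ∈ 𝒮, ∀ X ⊆ S, (∃ P ∈ 𝒬, X ∈ P) → X ∈ 𝒮
  sc3 : ∀ S ∈ 𝒮, {S, Sᶜ} ∈ 𝒬

/-- A weakly submodular scenario. -/
structure IsWeaklySubmodularScenario (𝒬 : Set (Finset (Finset α))) (𝒮 : Set (Finset α)) :
    Prop where
  isScenario : IsScenario 𝒬 𝒮
  weaklySubmodular : WeaklySubmodular 𝒬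

/-- A connectivity function: symmetric and submodular. -/
structure IsConnectivityFunction (f : Finset α → ℤ) : Prop where
  symmetric : ∀ X, f X = f Xᶜ
  submodular : ∀ X Y, f (X ∪ Y) + f (X ∩ Y) ≤ f X + f Y

/-- `Part_f^k`: the partitions `P` with `∑_{X ∈ P} f X ≤ k`. -/
def partitionsOf (f : Finset α → ℤ) (k : ℤ) : Set (Finset (Finset α)) :=
  {P | IsPartition P ∧ ∑ X ∈ P, f X ≤ k}

end Partitions

section Game

variable {α : Type*} [Fintype α] [DecidableEq α]

/-- While the captain moves from `P` to `P'`, the robber may run from `r` to `r'`: with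
`X ∈ P` the robber space and `Y ∈ P ∨ P'` the set containing `X`, the point `r'` lies in `Y`. -/
def RobberMove (P : Finset (Finset α)) (r : α) (P' : Finset (Finset α)) (r' : α) : Prop :=
  ∃ X ∈ P, r ∈ X ∧ ∃ Y ∈ commonCoarsening P P', X ⊆ Y ∧ r' ∈ Y

/-- The robber, standing on `r` behind the barrier `P`, is cornered in a set of `𝒮`. -/
def Caught (𝒮 : Set (Finset α)) (P : Finset (Finset α)) (r : α) : Prop :=
  ∃ X ∈ P, r ∈ X ∧ X ∈ 𝒮

/-- The captain's move from position `(P, r)` to `P'` is monotone: `P'` refines the robber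
space. -/
def MonotoneMove (P : Finset (Finset α)) (r : α) (P' : Finset (Finset α)) : Prop :=
  ∀ X ∈ P, r ∈ X → IsUnionOf X P'

/-- The partitions chosen by a captain who follows the strategy `σ` against a robber who visits
`r 0, r 1, …`. The first one is `{A}`; afterwards `σ` is applied to the list of all robber
positions so far (these and `σ` determine the captain's own earlier moves). -/
def captainPlay (σ : List α → Finset (Finset α)) (r : ℕ → α) : ℕ → Finset (Finset α)
  | 0 => {Finset.univ}
  | n + 1 => σ ((List.range (n + 1)).map r)

/-- All moves of the robber in the play are legal. -/
def LegalRobber (σ : List α → Finset (Finset α)) (r : ℕ → α) : Prop :=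
  ∀ n, RobberMove (captainPlay σ r n) (r n) (captainPlay σ r (n + 1)) (r (n + 1))

/-- The captain has a winning strategy in the captain and robber game on `(𝒬, 𝒮)`: the initial
partition `{A}` is allowed, and she has a strategy choosing partitions in `𝒬` that catches the
robber after finitely many moves, however he runs. -/
def CaptainWins (𝒬 : Set (Finset (Finset α))) (𝒮 : Set (Finset α)) : Prop :=
  {Finset.univ} ∈ 𝒬 ∧ ∃ σ : List α → Finset (Finset α), (∀ h, σ h ∈ 𝒬) ∧
    ∀ r : ℕ → α, LegalRobber σ r →
      ∃ n, Caught 𝒮 (captainPlay σ r (n + 1)) (r (n + 1))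

/-- The captain has a winning strategy in the monotone captain and robber game on `(𝒬, 𝒮)`: as
before, and every captain's move up to the one that catches the robber is monotone. -/
def CaptainWinsMonotone (𝒬 : Set (Finset (Finset α))) (𝒮 : Set (Finset α)) : Prop :=
  {Finset.univ} ∈ 𝒬 ∧ ∃ σ : List α → Finset (Finset α), (∀ h, σ h ∈ 𝒬) ∧
    ∀ r : ℕ → α, LegalRobber σ r →
      ∃ n, Caught 𝒮 (captainPlay σ r (n + 1)) (r (n + 1)) ∧
        ∀ m ≤ n, MonotoneMove (captainPlay σ r m) (r m) (captainPlay σ r (m + 1))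

/-- A monotone scenario: the captain can win the game iff she can win the monotone game. -/
def IsMonotoneScenario (𝒬 : Set (Finset (Finset α))) (𝒮 : Set (Finset α)) : Prop :=
  CaptainWins 𝒬 𝒮 ↔ CaptainWinsMonotone 𝒬 𝒮

end Game

section Brambles

variable {α : Type*} [Fintype α] [DecidableEq α]

/-- A bramble for `𝒬`. -/
structure IsBramble (𝒬 : Set (Finset (Finset α))) (ℬ : Set (Finset α)) : Prop where
  nonempty : ℬ.Nonempty
  members_nonempty : ∀ X ∈ ℬ, X.Nonempty
  intersecting : ∀ X ∈ ℬ, ∀ Y ∈ ℬ, (X ∩ Y).Nonempty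
  meets : ∀ P ∈ 𝒬, ∃ X ∈ P, X ∈ ℬ

/-- `𝒬` has a bramble avoiding `𝒮`. -/
def HasBrambleAvoiding (𝒬 : Set (Finset (Finset α))) (𝒮 : Set (Finset α)) : Prop :=
  ∃ ℬ : Set (Finset α), IsBramble 𝒬 ℬ ∧ Disjoint ℬ 𝒮

end Brambles

section Trees

variable {α : Type*} [Fintype α] [DecidableEq α] {V : Type*}

/-- A leaf is a node of degree at most one; the other nodes are internal. -/
def IsLeafNode (T : SimpleGraph V) (v : V) : Prop :=
  (T.neighborSet v).Subsingleton

open Classical in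
/-- The image `τ(L(T))`. -/
noncomputable def leafLabels (T : SimpleGraph V) (τ : V → Finset α) : Finset (Finset α) :=
  Finset.univ.filter fun X => ∃ v, IsLeafNode T v ∧ τ v = X

open Classical in
/-- The union of the labels `τ v` over the leaves `v` of `T` lying in the component `C` of
`T ∖ t`. -/
noncomputable def componentLabel (T : SimpleGraph V) (τ : V → Finset α) (t : V)
    (C : (T.induce ({t}ᶜ : Set V)).ConnectedComponent) : Finset α :=
  Finset.univ.filter fun a => ∃ v ∈ C.supp, IsLeafNode T v.1 ∧ a ∈ τ v.1

open Classical in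
/-- `P_t`: the set of the labels of the components of `T ∖ t`. -/
noncomputable def nodePartition (T : SimpleGraph V) (τ : V → Finset α) (t : V) :
    Finset (Finset α) :=
  Finset.univ.filter fun X =>
    ∃ C : (T.induce ({t}ᶜ : Set V)).ConnectedComponent, componentLabel T τ t C = X

/-- `(T, τ)` is a tree decomposition for `(𝒬, 𝒮)`. Only the values of `τ` at leaves matter. -/
structure IsTreeDecomposition (𝒬 : Set (Finset (Finset α))) (𝒮 : Set (Finset α))
    (T : SimpleGraph V) (τ : V → Finset α) : Prop where
  isTree : T.IsTree
  leaf_mem : ∀ v, IsLeafNode T v → τ v ∈ 𝒮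
  td1 : IsPartition (leafLabels T τ)
  td2 : ∀ t, ¬ IsLeafNode T t → nodePartition T τ t ∈ 𝒬

/-- `(𝒬, 𝒮)` has a tree decomposition (over a finite tree). -/
def HasTreeDecomposition (𝒬 : Set (Finset (Finset α))) (𝒮 : Set (Finset α)) : Prop :=
  ∃ (V : Type) (_ : Finite V) (T : SimpleGraph V) (τ : V → Finset α),
    IsTreeDecomposition 𝒬 𝒮 T τ

open Classical in
/-- `π_t`: the set of the labels of the arcs leaving `t`. -/
noncomputable def outLabels (T : SimpleGraph V) (l : V → V → Finset α) (t : V) :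
    Finset (Finset α) :=
  Finset.univ.filter fun X => ∃ u, T.Adj t u ∧ l t u = X

/-- `(T, l)` is a search tree for the ground set. The bidirected tree is given by its underlying
tree `T`, which has at least one edge; `l s t` is the label of the arc `(s, t)` and matters only
when `s` and `t` are adjacent. -/
structure IsSearchTree (T : SimpleGraph V) (l : V → V → Finset α) : Prop where
  isTree : T.IsTree
  has_edge : ∃ s t, T.Adj s t
  st1 : ∀ t, ¬ IsLeafNode T t → IsPartition (outLabels T l t)
  st2 : ∀ s t, T.Adj s t → Disjoint (l s t) (l t s)

/-- `(T, l)` is a search tree for the pair `(𝒬, 𝒮)`. -/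
structure IsSearchTreeFor (𝒬 : Set (Finset (Finset α))) (𝒮 : Set (Finset α))
    (T : SimpleGraph V) (l : V → V → Finset α) : Prop where
  isSearchTree : IsSearchTree T l
  node_mem : ∀ t, ¬ IsLeafNode T t → outLabels T l t ∈ 𝒬
  leaf_mem : ∀ s t, T.Adj s t → IsLeafNode T t → l s t ∈ 𝒮

/-- `(T, l)` is exact: the two labels of every 2-cycle cover the ground set. -/
def IsExact (T : SimpleGraph V) (l : V → V → Finset α) : Prop :=
  ∀ s t, T.Adj s t → l s t ∪ l t s = Finset.univ

/-- `(𝒬, 𝒮)` has an exact search tree (over a finite tree). -/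
def HasExactSearchTree (𝒬 : Set (Finset (Finset α))) (𝒮 : Set (Finset α)) : Prop :=
  ∃ (V : Type) (_ : Finite V) (T : SimpleGraph V) (l : V → V → Finset α),
    IsSearchTreeFor 𝒬 𝒮 T l ∧ IsExact T l

end Trees

end CaptainRobber

open CaptainRobber

set_option linter.unusedSectionVars false

namespace CaptainRobber

/-! ### Submodular inequalities for partitions, and the scenario axioms -/

section Submodularity

variable {α : Type*} [Fintype α] [DecidableEq α]

/-! Each of (a)–(d) excludes a bramble avoiding `𝒮`, because such a bramble is an escape plan. The
robber always runs into the bramble member of the new partition, which is legal since bramble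
members intersect. In a tree the bramble points along arcs until it arrives at a leaf, whose label
lies in `𝒮`.

The substance is the converse. A set is `Fillable` if it labels an arc behind which an exact search
tree can be completed, so a search tree amounts to fillings of some `U` and of `Uᶜ`.
`exists_fillable_compl` shows that a bramble exists when there is no such `U`: enlarge `𝒮` to a
maximal downward closed `𝒩` still admitting no complementary fillings, and take the sets outside
`𝒩`. They meet every partition, since a partition inside `𝒩` would be a search tree with one
internal node. Suppose two of them were disjoint, and shrink them to minimal sets `X₀`, `Y₀` outside
`𝒩`. By maximality, allowing `X₀` as a leaf creates complementary fillings, and rerooting at that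
leaf (`Fillable.or_of_insert`) fills `X₀ᶜ` over `𝒩`; likewise `Y₀ᶜ`. If `V` minimises `f` between
`Y₀` and `X₀ᶜ`, then `Fillable.of_linked` cuts these fillings down to fillings of `V` and `Vᶜ`, a
contradiction. Submodularity enters here, and in weak submodularity, through `sum_shift_le`.

Complementary fillings unfold into two rooted trees joined at their roots, which gives (a) and (b),
and they describe a monotone strategy, which gives (c). The monotonicity of the scenario needs no
covering assumption: a robber who never moves shows that a winning captain forces `⋃ 𝒮 = A`. -/

theorem IsPartition.eq_of_mem {P : Finset (Finset α)} (hP : IsPartition P) {X Y : Finset α}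
    (hX : X ∈ P) (hY : Y ∈ P) {a : α} (haX : a ∈ X) (haY : a ∈ Y) : X = Y := by
  by_contra h
  exact Finset.disjoint_left.1 (hP.disjoint X hX Y hY h) haX haY

theorem IsPartition.nonempty [Nonempty α] {P : Finset (Finset α)} (hP : IsPartition P) :
    P.Nonempty := by
  obtain ⟨X, hX, -⟩ := hP.cover (Classical.arbitrary α)
  exact ⟨X, hX⟩

theorem IsPartition.sup_erase {P : Finset (Finset α)} (hP : IsPartition P) {X : Finset α}
    (hX : X ∈ P) : (P.erase X).sup id = Xᶜ := by
  ext a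
  simp only [Finset.mem_sup, Finset.mem_erase, id, Finset.mem_compl]
  constructor
  · rintro ⟨Z, ⟨hne, hZ⟩, ha⟩ haX
    exact hne (hP.eq_of_mem hZ hX ha haX)
  · intro ha
    obtain ⟨Z, hZ, haZ⟩ := hP.cover a
    exact ⟨Z, ⟨fun h => ha (h ▸ haZ), hZ⟩, haZ⟩

theorem isPartition_univ : IsPartition ({Finset.univ} : Finset (Finset α)) where
  disjoint X hX Y hY h := by simp_all
  cover a := ⟨Finset.univ, by simp, by simp⟩

theorem isPartition_pair_compl (S : Finset α) : IsPartition ({S, Sᶜ} : Finset (Finset α)) where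
  disjoint X hX Y hY h := by
    simp only [Finset.mem_insert, Finset.mem_singleton] at hX hY
    rcases hX with rfl | rfl <;> rcases hY with rfl | rfl
    · exact absurd rfl h
    · exact disjoint_compl_right
    · exact disjoint_compl_left
    · exact absurd rfl h
  cover a := by
    by_cases ha : a ∈ S
    · exact ⟨S, by simp, ha⟩
    · exact ⟨Sᶜ, by simp, by simpa using ha⟩

theorem IsPartition.shift {P : Finset (Finset α)} (hP : IsPartition P) {X F : Finset α}
    (hX : X ∈ P) : IsPartition (shift P X F) where
  disjoint := by
    have key : ∀ Z ∈ P, Z ≠ X → Disjoint (X ∪ F) (Z \ F) := by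
      intro Z hZ hne
      rw [Finset.disjoint_union_left]
      exact ⟨(hP.disjoint X hX Z hZ hne.symm).mono_right Finset.sdiff_subset,
        Finset.disjoint_sdiff⟩
    intro Y hY Z hZ hne
    simp only [CaptainRobber.shift, Finset.mem_insert, Finset.mem_image, Finset.mem_erase] at hY hZ
    rcases hY with rfl | ⟨Y, ⟨hYX, hY⟩, rfl⟩ <;> rcases hZ with rfl | ⟨Z, ⟨hZX, hZ⟩, rfl⟩
    · exact absurd rfl hne
    · exact key Z hZ hZX
    · exact (key Y hY hYX).symm
    · exact (hP.disjoint Y hY Z hZ (fun h => hne (h ▸ rfl))).mono Finset.sdiff_subset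
        Finset.sdiff_subset
  cover a := by
    simp only [CaptainRobber.shift, Finset.mem_insert, Finset.mem_image, Finset.mem_erase]
    by_cases ha : a ∈ X ∪ F
    · exact ⟨_, Or.inl rfl, ha⟩
    · obtain ⟨Z, hZ, haZ⟩ := hP.cover a
      simp only [Finset.mem_union, not_or] at ha
      exact ⟨Z \ F, Or.inr ⟨Z, ⟨fun h => ha.1 (h ▸ haZ), hZ⟩, rfl⟩, by simp [haZ, ha.2]⟩

namespace IsConnectivityFunction

variable {f : Finset α → ℤ}

/-- Submodularity for `X` and `Xᶜ` together with symmetry gives `2 f X ≥ 2 f ∅`. -/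
theorem nonneg (hf : IsConnectivityFunction f) (hf0 : 0 ≤ f ∅) (X : Finset α) : 0 ≤ f X := by
  have h := hf.submodular X Xᶜ
  have h1 := hf.symmetric X
  have h2 := hf.symmetric ∅
  simp at h h2
  omega

/-- Nonnegativity allows the intersection terms to be dropped. The family must be nonempty because
`f ∅` may be positive. -/
theorem sup_le_sum (hf : IsConnectivityFunction f) (hf0 : 0 ≤ f ∅) {C : Finset (Finset α)}
    (hC : C.Nonempty) : f (C.sup id) ≤ ∑ X ∈ C, f X := by
  induction hC using Finset.Nonempty.cons_induction with
  | singleton X => simp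
  | cons X C hX hC ih =>
    rw [Finset.sum_cons, Finset.sup_cons]
    have h1 := hf.submodular X (C.sup id)
    have h2 := hf.nonneg hf0 (X ∩ C.sup id)
    simp only [id, Finset.sup_eq_union] at h1 ⊢
    omega

/-- Iterated submodularity for a set `Y` and the members of a disjoint family. -/
theorem sum_inter_add_le (hf : IsConnectivityFunction f) (Y : Finset α) (C : Finset (Finset α))
    (hC : ∀ X ∈ C, ∀ Z ∈ C, X ≠ Z → Disjoint X Z) :
    ∑ Z ∈ C, f (Z ∩ Y) + f (Y ∪ C.sup id) ≤ f Y + ∑ Z ∈ C, f Z := by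
  induction C using Finset.induction_on with
  | empty => simp
  | insert X C hX ih =>
    have ih := ih fun X hX Z hZ => hC X (Finset.mem_insert_of_mem hX) Z (Finset.mem_insert_of_mem hZ)
    rw [Finset.sum_insert hX, Finset.sum_insert hX, Finset.sup_insert]
    have h1 := hf.submodular X (Y ∪ C.sup id)
    have h2 : X ∩ (Y ∪ C.sup id) = X ∩ Y := by
      have : Disjoint X (C.sup id) := by
        rw [Finset.disjoint_sup_right]
        intro Z hZ
        exact hC X (by simp) Z (by simp [hZ]) (fun h => hX (h ▸ hZ))
      rw [Finset.inter_union_distrib_left, Finset.disjoint_iff_inter_eq_empty.1 this,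
        Finset.union_empty]
    have h3 : Y ∪ (id X ⊔ C.sup id) = X ∪ (Y ∪ C.sup id) := by
      simp only [id, Finset.sup_eq_union]
      ac_rfl
    rw [h2] at h1
    rw [h3]
    omega

/-- With `F` the whole complement of `X ∪ Y`, the member `X` becomes `X ∪ Yᶜ` and every other member
`Z` becomes `Z ∩ Y`. The other members are disjoint with union `Xᶜ`, so iterated submodularity
bounds their total; members that coincide after the shift only lower the sum, as `f` is nonnegative.
The error term changes sign when `X` and `Y` are swapped. -/
theorem sum_shift_le (hf : IsConnectivityFunction f) (hf0 : 0 ≤ f ∅) {P : Finset (Finset α)}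
    (hP : IsPartition P) {X : Finset α} (hX : X ∈ P) (Y : Finset α) :
    ∑ Z ∈ shift P X (X ∪ Y)ᶜ, f Z ≤
      ∑ Z ∈ P, f Z + (f Y - f (Y ∪ Xᶜ)) + (f (X ∪ Yᶜ) - f X) := by
  have hXY : X ∪ (X ∪ Y)ᶜ = X ∪ Yᶜ := by
    ext a; simp only [Finset.mem_union, Finset.mem_compl]; tauto
  have h1 : ∑ Z ∈ shift P X (X ∪ Y)ᶜ, f Z ≤
      f (X ∪ Yᶜ) + ∑ Z ∈ (P.erase X).image (fun Z => Z \ (X ∪ Y)ᶜ), f Z := by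
    rw [shift, hXY]
    by_cases h : X ∪ Yᶜ ∈ (P.erase X).image (fun Z => Z \ (X ∪ Y)ᶜ)
    · rw [Finset.insert_eq_of_mem h]
      have := hf.nonneg hf0 (X ∪ Yᶜ)
      omega
    · rw [Finset.sum_insert h]
  have h2 : ∑ Z ∈ (P.erase X).image (fun Z => Z \ (X ∪ Y)ᶜ), f Z ≤
      ∑ Z ∈ P.erase X, f (Z \ (X ∪ Y)ᶜ) :=
    Finset.sum_image_le_of_nonneg fun Z _ => hf.nonneg hf0 _
  have h3 : ∑ Z ∈ P.erase X, f (Z \ (X ∪ Y)ᶜ) = ∑ Z ∈ P.erase X, f (Z ∩ Y) := by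
    refine Finset.sum_congr rfl fun Z hZ => congrArg f ?_
    have hd := hP.disjoint X hX Z (Finset.mem_of_mem_erase hZ) (Finset.ne_of_mem_erase hZ).symm
    ext a
    have := fun ha : a ∈ X => Finset.disjoint_left.1 hd ha
    simp only [Finset.mem_sdiff, Finset.mem_compl, Finset.mem_union, Finset.mem_inter]
    tauto
  have h4 := hf.sum_inter_add_le Y (P.erase X) fun Z hZ W hW =>
    hP.disjoint Z (Finset.mem_of_mem_erase hZ) W (Finset.mem_of_mem_erase hW)
  rw [hP.sup_erase hX] at h4
  have h5 := Finset.add_sum_erase P f hX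
  omega

end IsConnectivityFunction

theorem weaklySubmodular_partitionsOf {f : Finset α → ℤ} (hf : IsConnectivityFunction f)
    (hf0 : 0 ≤ f ∅) (k : ℤ) : WeaklySubmodular (partitionsOf f k) := by
  rintro P ⟨hP, hPk⟩ Q ⟨hQ, hQk⟩ X hX Y hY hne
  refine ⟨_, hne, Finset.Subset.refl _, ?_⟩
  -- The error terms of the two shifts cancel, so the two new sums add up to at most `2k` and cannot
  -- both exceed `k`.
  have h1 := hf.sum_shift_le hf0 hP hX Y
  have h2 := hf.sum_shift_le hf0 hQ hY X
  have h3 := hf.symmetric (Y ∪ Xᶜ)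
  have h4 := hf.symmetric (X ∪ Yᶜ)
  have h5 := hf.submodular X (Yᶜ)
  by_contra! h
  have hP' : k < ∑ Z ∈ shift P X (X ∪ Y)ᶜ, f Z := by
    by_contra! h'
    exact h.1 ⟨hP.shift hX, h'⟩
  have hQ' : k < ∑ Z ∈ shift Q Y (X ∪ Y)ᶜ, f Z := by
    by_contra! h'
    exact h.2 ⟨hQ.shift hY, h'⟩
  rw [Finset.union_comm Y X] at h2
  omega

/-- Each member of `P` is charged to members of `Q` inside it. The empty set is dropped from the
family of a nonempty member, which makes the families of distinct members disjoint; what is left of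
`Q` contributes a nonnegative amount. -/
theorem sum_le_of_isCoarser {f : Finset α → ℤ} (hf : IsConnectivityFunction f)
    (hf0 : 0 ≤ f ∅) {P Q : Finset (Finset α)} (hP : IsPartition P) (h : IsCoarser P Q) :
    ∑ X ∈ P, f X ≤ ∑ Z ∈ Q, f Z := by
  classical
  have key : ∀ X ∈ P, ∃ C ⊆ Q, f X ≤ ∑ Z ∈ C, f Z ∧ (∀ Z ∈ C, Z ⊆ X) ∧
      (∅ ∈ C → X = ∅) := by
    intro X hX
    obtain ⟨C, hCQ, hC, rfl⟩ := h X hX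
    by_cases hX0 : C.sup id = ∅
    · exact ⟨C, hCQ, hf.sup_le_sum hf0 hC, fun Z hZ => Finset.le_sup (f := id) hZ, fun _ => hX0⟩
    · have hsup : (C.erase ∅).sup id = C.sup id := Finset.sup_erase_bot C
      refine ⟨C.erase ∅, (Finset.erase_subset _ _).trans hCQ, ?_, fun Z hZ =>
        Finset.le_sup (f := id) (Finset.mem_of_mem_erase hZ), fun h => by simp at h⟩
      conv_lhs => rw [← hsup]
      apply hf.sup_le_sum hf0
      by_contra hemp
      rw [Finset.not_nonempty_iff_eq_empty] at hemp
      rw [hemp] at hsup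
      exact hX0 hsup.symm
  choose! C hCQ hC hsub hemp using key
  calc ∑ X ∈ P, f X ≤ ∑ X ∈ P, ∑ Z ∈ C X, f Z := Finset.sum_le_sum hC
    _ = ∑ Z ∈ P.biUnion C, f Z := by
      rw [Finset.sum_biUnion]
      intro X hX Y hY hne
      rw [Function.onFun, Finset.disjoint_left]
      intro Z hZX hZY
      have : Z = ∅ := by
        have := hP.disjoint X hX Y hY hne
        simpa using this (hsub X hX Z hZX) (hsub Y hY Z hZY)
      subst this
      exact hne ((hemp X hX hZX).trans (hemp Y hY hZY).symm)
    _ ≤ ∑ Z ∈ Q, f Z := by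
      apply Finset.sum_le_sum_of_subset_of_nonneg
      · exact Finset.biUnion_subset.2 hCQ
      · exact fun Z _ _ => hf.nonneg hf0 Z

theorem pair_compl_mem_partitionsOf [Nonempty α] {f : Finset α → ℤ}
    (hf : IsConnectivityFunction f) {k : ℤ} {S : Finset α} (hS : 2 * f S ≤ k) :
    ({S, Sᶜ} : Finset (Finset α)) ∈ partitionsOf f k := by
  refine ⟨isPartition_pair_compl S, ?_⟩
  have hne : S ≠ Sᶜ := by
    intro h
    obtain ⟨a⟩ := ‹Nonempty α›
    have := congrArg (a ∈ ·) h
    simp at this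
  rw [Finset.sum_pair hne, ← hf.symmetric]
  omega

theorem isScenario_partitionsOf [Nonempty α] {f : Finset α → ℤ}
    (hf : IsConnectivityFunction f) (hf0 : 0 ≤ f ∅) {𝒮 : Set (Finset α)}
    (h𝒮 : ∀ S ∈ 𝒮, ∀ S' ⊆ S, S' ∈ 𝒮) {k : ℤ} (hk : ∀ S ∈ 𝒮, 2 * f S ≤ k) :
    IsScenario (partitionsOf f k) 𝒮 where
  isPartition _ hP := hP.1
  sc1 _ hQ _ hP h := ⟨hP, (sum_le_of_isCoarser hf hf0 hP h).trans hQ.2⟩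
  sc2 S hS X hX _ := h𝒮 S hS X hX
  sc3 S hS := pair_compl_mem_partitionsOf hf (hk S hS)

end Submodularity

end CaptainRobber

namespace CaptainRobber

/-! ### Fillings of arcs and the construction of a bramble -/

section Fillable

variable {α : Type*} [Fintype α] [DecidableEq α]

/-- `X` is the label of an arc of an exact search tree behind which all leaf labels lie in `𝒩`. -/
inductive Fillable (𝒬 : Set (Finset (Finset α))) (𝒩 : Set (Finset α)) : Finset α → Prop
  | base {X : Finset α} : X ∈ 𝒩 → Fillable 𝒬 𝒩 X
  | node {X : Finset α} {P : Finset (Finset α)} : P ∈ 𝒬 → Xᶜ ∈ P →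
      (∀ Z ∈ P, Z ≠ Xᶜ → Fillable 𝒬 𝒩 Z) → Fillable 𝒬 𝒩 X

namespace Fillable

variable {𝒬 : Set (Finset (Finset α))} {𝒩 : Set (Finset α)}

/-- The filling of `X` is intersected with `V`: at each node the complementary member absorbs `X \
V` and every other `Z` becomes `Z ∩ V`. As `V` minimises `f` between `V` and `X`, both error terms
of the shift are at most `0`, so the bound `k` survives. -/
theorem of_linked {f : Finset α → ℤ} (hf : IsConnectivityFunction f) (hf0 : 0 ≤ f ∅) {k : ℤ}
    (h𝒩 : ∀ S ∈ 𝒩, ∀ S' ⊆ S, S' ∈ 𝒩) {X : Finset α} (hX : Fillable (partitionsOf f k) 𝒩 X)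
    {V : Finset α} (hVX : V ⊆ X) (hV : ∀ V', V ⊆ V' → V' ⊆ X → f V ≤ f V') :
    Fillable (partitionsOf f k) 𝒩 V := by
  induction hX generalizing V with
  | base hX => exact base (h𝒩 _ hX V hVX)
  | @node X P hP hXP _ ih =>
    obtain ⟨hP, hPk⟩ := hP
    refine node (P := shift P Xᶜ (Xᶜ ∪ V)ᶜ) ⟨hP.shift hXP, ?_⟩ ?_ ?_
    · have h1 := hf.sum_shift_le hf0 hP hXP V
      have h2 : V ∪ Xᶜᶜ = X := by rw [compl_compl]; exact Finset.union_eq_right.2 hVX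
      have h3 : Xᶜ ∪ Vᶜ = Vᶜ := Finset.union_eq_right.2 (Finset.compl_subset_compl.2 hVX)
      rw [h2, h3, ← hf.symmetric, ← hf.symmetric] at h1
      have := hV X hVX subset_rfl
      omega
    · refine Finset.mem_insert.2 (Or.inl ?_)
      ext a
      have := @hVX a
      simp only [Finset.mem_union, Finset.mem_compl]
      tauto
    · intro W hW hne
      rw [shift, Finset.mem_insert] at hW
      rcases hW with rfl | hW
      · refine absurd ?_ hne
        ext a
        have := @hVX a
        simp only [Finset.mem_union, Finset.mem_compl]
        tauto
      · obtain ⟨Z, hZ, rfl⟩ := Finset.mem_image.1 hW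
        rw [Finset.mem_erase] at hZ
        have hZX : Z ⊆ X := by
          intro a ha
          by_contra hax
          exact hZ.1 (hP.eq_of_mem hZ.2 hXP ha (Finset.mem_compl.2 hax))
        have hZV : Z \ (Xᶜ ∪ V)ᶜ = Z ∩ V := by
          ext a
          have := @hZX a
          simp only [Finset.mem_sdiff, Finset.mem_compl, Finset.mem_union, Finset.mem_inter]
          tauto
        rw [hZV]
        refine ih Z hZ.2 hZ.1 Finset.inter_subset_left fun U hU hUZ => ?_
        -- The minimality passes to `Z ∩ V` inside `Z`: uncrossing `U` with `V` yields `U ∩ V = Z ∩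
        -- V` and a set `U ∪ V` between `V` and `X`, where `f` is at least `f V`.
        have h1 := hf.submodular U V
        have h2 : U ∩ V = Z ∩ V := by
          apply Finset.Subset.antisymm (Finset.inter_subset_inter_right hUZ)
          exact Finset.subset_inter hU Finset.inter_subset_right
        have h3 := hV (U ∪ V) Finset.subset_union_right (Finset.union_subset (hUZ.trans hZX) hVX)
        rw [h2] at h1
        omega

/-- If the filling of `U` really needs the new leaf `X`, then reversing the arcs on the way to that
leaf turns a filling of `Uᶜ` into one of `Xᶜ`. Since `X` is nonempty, two distinct members of a
partition cannot both contain it, so at each node at most one branch depends on the new leaf. -/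
theorem or_of_insert (h𝒬 : ∀ P ∈ 𝒬, IsPartition P) {X : Finset α} (hX : X.Nonempty)
    {U : Finset α} (hU : Fillable 𝒬 (insert X 𝒩) U) :
    Fillable 𝒬 𝒩 U ∨ (X ⊆ U ∧ (Fillable 𝒬 𝒩 Uᶜ → Fillable 𝒬 𝒩 Xᶜ)) := by
  induction hU with
  | base h =>
    rcases h with rfl | h
    · exact Or.inr ⟨subset_rfl, id⟩
    · exact Or.inl (base h)
  | @node U P hP hUP _ ih =>
    by_cases hall : ∀ Z ∈ P, Z ≠ Uᶜ → Fillable 𝒬 𝒩 Z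
    · exact Or.inl (node hP hUP hall)
    · right
      push Not at hall
      obtain ⟨Z, hZ, hZU, hnot⟩ := hall
      obtain ⟨hXZ, himp⟩ := (ih Z hZ hZU).resolve_left hnot
      obtain ⟨x, hx⟩ := hX
      -- The same partition `P` is read from `Z` instead of from `Uᶜ`: the given filling of `Uᶜ`
      -- replaces the branch `Z`, and every other branch is fillable over `𝒩`.
      refine ⟨?_, fun hUc => himp (node hP (by rwa [compl_compl]) fun W hW hWZ => ?_)⟩
      · intro a ha
        by_contra hau
        exact hZU ((h𝒬 P hP).eq_of_mem hZ hUP (hXZ ha) (Finset.mem_compl.2 hau))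
      · rw [compl_compl] at hWZ
        by_cases hWU : W = Uᶜ
        · exact hWU ▸ hUc
        · refine (ih W hW hWU).resolve_right fun h => hWZ ?_
          exact (h𝒬 P hP).eq_of_mem hW hZ (h.1 hx) (hXZ hx)

end Fillable

theorem exists_fillable_compl [Nonempty α] {f : Finset α → ℤ} (hf : IsConnectivityFunction f)
    (hf0 : 0 ≤ f ∅) {k : ℤ} {𝒮 : Set (Finset α)} (h𝒮 : ∀ S ∈ 𝒮, ∀ S' ⊆ S, S' ∈ 𝒮)
    (hemp : ∅ ∈ 𝒮) (hB : ¬ HasBrambleAvoiding (partitionsOf f k) 𝒮) :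
    ∃ U, Fillable (partitionsOf f k) 𝒮 U ∧ Fillable (partitionsOf f k) 𝒮 Uᶜ := by
  by_contra hcon
  obtain ⟨𝒩, h𝒮𝒩, ⟨hdown, hcons⟩, hmax⟩ := Finite.exists_le_maximal (α := Set (Finset α))
    (p := fun 𝒩 => (∀ S ∈ 𝒩, ∀ S' ⊆ S, S' ∈ 𝒩) ∧
      ¬ ∃ U, Fillable (partitionsOf f k) 𝒩 U ∧ Fillable (partitionsOf f k) 𝒩 Uᶜ)
    (a := 𝒮) ⟨h𝒮, hcon⟩
  have hpart : ∀ P ∈ partitionsOf f k, IsPartition P := fun P hP => hP.1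
  have hempN : ∅ ∈ 𝒩 := h𝒮𝒩 hemp
  have hmin : ∀ X, X ∉ 𝒩 → ∃ X₀ ⊆ X, X₀ ∉ 𝒩 ∧ Fillable (partitionsOf f k) 𝒩 X₀ᶜ := by
    intro X hX
    obtain ⟨X₀, hX₀X, hX₀, hX₀min⟩ := Finite.exists_le_minimal (p := fun Z => Z ∉ 𝒩) hX
    refine ⟨X₀, hX₀X, hX₀, ?_⟩
    have hne : X₀.Nonempty := by
      rw [Finset.nonempty_iff_ne_empty]
      rintro rfl
      exact hX₀ hempN
    have hins : ∃ U, Fillable (partitionsOf f k) (insert X₀ 𝒩) U ∧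
        Fillable (partitionsOf f k) (insert X₀ 𝒩) Uᶜ := by
      by_contra hno
      -- Minimality of `X₀` outside `𝒩` keeps `insert X₀ 𝒩` downward closed, so maximality of `𝒩`
      -- would absorb it.
      refine hX₀ (hmax (y := insert X₀ 𝒩) ⟨?_, hno⟩ (Set.subset_insert _ _)
        (Set.mem_insert _ _))
      rintro S (rfl | hS) S' hS'
      · by_cases h : S' ∈ 𝒩
        · exact Or.inr h
        · exact Or.inl (Finset.Subset.antisymm hS' (hX₀min h hS'))
      · exact Or.inr (hdown S hS S' hS')
    obtain ⟨U, hU, hUc⟩ := hins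
    have h1 := hU.or_of_insert hpart hne
    have h2 := hUc.or_of_insert hpart hne
    obtain ⟨x, hx⟩ := hne
    rcases h1 with h1 | ⟨h1, h1'⟩ <;> rcases h2 with h2 | ⟨h2, h2'⟩
    · exact absurd ⟨U, h1, h2⟩ hcons
    · exact h2' (by rwa [compl_compl])
    · exact h1' h2
    · exact absurd (h1 hx) (Finset.mem_compl.1 (h2 hx))
  refine hB ⟨𝒩ᶜ, ⟨⟨Finset.univ, fun h => hcons ⟨∅, .base hempN, .base (by simpa using h)⟩⟩,
    ?_, ?_, ?_⟩, Set.disjoint_left.2 fun X hX hX' => hX (h𝒮𝒩 hX')⟩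
  · intro X hX
    rw [Finset.nonempty_iff_ne_empty]
    rintro rfl
    exact hX hempN
  · intro X hX Y hY
    by_contra hXY
    obtain ⟨X₀, hX₀, -, hfX⟩ := hmin X hX
    obtain ⟨Y₀, hY₀, -, hfY⟩ := hmin Y hY
    have hd : Y₀ ⊆ X₀ᶜ := by
      intro a ha
      rw [Finset.mem_compl]
      intro ha'
      exact hXY ⟨a, Finset.mem_inter.2 ⟨hX₀ ha', hY₀ ha⟩⟩
    -- One minimiser serves both sides: it is linked to `X₀ᶜ`, and by symmetry of `f` its complement
    -- is linked to `Y₀ᶜ`.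
    obtain ⟨V, hV, hVmin⟩ := Finset.exists_min_image (Finset.Icc Y₀ X₀ᶜ) f
      ⟨Y₀, Finset.mem_Icc.2 ⟨subset_rfl, hd⟩⟩
    obtain ⟨hYV, hVX⟩ := Finset.mem_Icc.1 hV
    refine hcons ⟨V, hfX.of_linked hf hf0 hdown hVX fun V' h1 h2 =>
      hVmin V' (Finset.mem_Icc.2 ⟨hYV.trans h1, h2⟩),
      hfY.of_linked hf hf0 hdown (Finset.compl_subset_compl.2 hYV) fun V' h1 h2 => ?_⟩
    rw [← hf.symmetric, hf.symmetric V']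
    refine hVmin _ (Finset.mem_Icc.2 ⟨?_, ?_⟩)
    · exact Finset.subset_compl_comm.1 h2
    · have := Finset.compl_subset_compl.2 h1
      rw [compl_compl] at this
      exact this.trans hVX
  · intro P hP
    by_contra! hall
    obtain ⟨Z, hZ⟩ := (hpart P hP).nonempty
    have hN : ∀ W ∈ P, W ∈ 𝒩 := fun W hW => not_not.1 (hall W hW)
    exact hcons ⟨Z, .base (hN Z hZ), .node hP (by rwa [compl_compl]) fun W hW _ =>
      .base (hN W hW)⟩

end Fillable

end CaptainRobber

namespace CaptainRobber

/-! ### Robber moves, strategies and escapes -/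

section GamePlay

variable {α : Type*} [Fintype α] [DecidableEq α]

theorem IsUnionOf.subset_of_mem {P : Finset (Finset α)} (hP : IsPartition P) {Y X : Finset α}
    (hY : IsUnionOf Y P) (hX : X ∈ P) {a : α} (haX : a ∈ X) (haY : a ∈ Y) : X ⊆ Y := by
  obtain ⟨C, hCP, -, rfl⟩ := hY
  obtain ⟨Z, hZ, haZ⟩ := Finset.mem_sup.1 haY
  rw [hP.eq_of_mem hX (hCP hZ) haX haZ]
  exact Finset.le_sup (f := id) hZ

theorem isUnionOf_of_saturated {P : Finset (Finset α)} (hP : IsPartition P) {Y : Finset α}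
    (hY : Y.Nonempty) (h : ∀ X ∈ P, ∀ a ∈ X, a ∈ Y → X ⊆ Y) : IsUnionOf Y P := by
  have hcov : ∀ a ∈ Y, ∃ X ∈ P.filter (· ⊆ Y), a ∈ X := by
    intro a ha
    obtain ⟨X, hX, haX⟩ := hP.cover a
    exact ⟨X, Finset.mem_filter.2 ⟨hX, h X hX a haX ha⟩, haX⟩
  refine ⟨P.filter (· ⊆ Y), Finset.filter_subset _ _, ?_, ?_⟩
  · obtain ⟨a, ha⟩ := hY
    obtain ⟨X, hX, -⟩ := hcov a ha
    exact ⟨X, hX⟩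
  · ext a
    rw [Finset.mem_sup]
    constructor
    · rintro ⟨X, hX, haX⟩
      exact (Finset.mem_filter.1 hX).2 haX
    · exact hcov a

theorem isUnionOf_self {P : Finset (Finset α)} {X : Finset α} (hX : X ∈ P) : IsUnionOf X P :=
  ⟨{X}, by simpa using hX, by simp, by simp⟩

theorem isUnionOf_sdiff {P : Finset (Finset α)} (hP : IsPartition P) {Y Z : Finset α}
    (hY : IsUnionOf Y P) (hZ : IsUnionOf Z P) (hne : (Y \ Z).Nonempty) : IsUnionOf (Y \ Z) P := by
  refine isUnionOf_of_saturated hP hne fun X hX a haX ha b hb => ?_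
  rw [Finset.mem_sdiff] at ha ⊢
  exact ⟨hY.subset_of_mem hP hX haX ha.1 hb,
    fun hbZ => ha.2 (hZ.subset_of_mem hP hX hb hbZ haX)⟩

theorem mem_commonCoarsening {P Q : Finset (Finset α)} {X : Finset α} :
    X ∈ commonCoarsening P Q ↔ IsUnionOf X P ∧ IsUnionOf X Q ∧
      ∀ Z ⊆ X, Z.Nonempty → IsUnionOf Z P → IsUnionOf Z Q → Z = X := by
  simp [commonCoarsening]

/-- Take a minimal common union `Y` containing `a`. A smaller common union `Z` avoiding `a` could be
removed, since `Y \ Z` is again a common union, contradicting minimality. -/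
theorem exists_mem_commonCoarsening {P Q : Finset (Finset α)} (hP : IsPartition P)
    (hQ : IsPartition Q) (a : α) : ∃ Y ∈ commonCoarsening P Q, a ∈ Y := by
  have huniv : ∀ {R : Finset (Finset α)}, IsPartition R → IsUnionOf Finset.univ R := fun hR =>
    isUnionOf_of_saturated hR ⟨a, by simp⟩ fun X _ _ _ _ => Finset.subset_univ X
  obtain ⟨Y, -, ⟨haY, hYP, hYQ⟩, hmin⟩ := Finite.exists_le_minimal
    (p := fun Y : Finset α => a ∈ Y ∧ IsUnionOf Y P ∧ IsUnionOf Y Q)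
    ⟨Finset.mem_univ a, huniv hP, huniv hQ⟩
  refine ⟨Y, mem_commonCoarsening.2 ⟨hYP, hYQ, fun Z hZY hZ hZP hZQ => ?_⟩, haY⟩
  by_cases haZ : a ∈ Z
  · exact Finset.Subset.antisymm hZY (hmin ⟨haZ, hZP, hZQ⟩ hZY)
  · have ha : a ∈ Y \ Z := Finset.mem_sdiff.2 ⟨haY, haZ⟩
    have hsub := hmin ⟨ha, isUnionOf_sdiff hP hYP hZP ⟨a, ha⟩, isUnionOf_sdiff hQ hYQ hZQ ⟨a, ha⟩⟩
      Finset.sdiff_subset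
    obtain ⟨z, hz⟩ := hZ
    exact absurd hz (Finset.mem_sdiff.1 (hsub (hZY hz))).2

/-- The robber may run to any point of a member of `P'` that meets his current space. -/
theorem robberMove_of_inter {P P' : Finset (Finset α)} (hP : IsPartition P)
    (hP' : IsPartition P') {X X' : Finset α} (hX : X ∈ P) (hX' : X' ∈ P')
    (hne : (X ∩ X').Nonempty) {r r' : α} (hr : r ∈ X) (hr' : r' ∈ X') : RobberMove P r P' r' := by
  obtain ⟨a, ha⟩ := hne
  rw [Finset.mem_inter] at ha
  obtain ⟨Y, hY, haY⟩ := exists_mem_commonCoarsening hP hP' a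
  have hY' := mem_commonCoarsening.1 hY
  exact ⟨X, hX, hr, Y, hY, hY'.1.subset_of_mem hP hX ha.1 haY,
    hY'.2.1.subset_of_mem hP' hX' ha.2 haY hr'⟩

theorem robberMove_self {P P' : Finset (Finset α)} (hP : IsPartition P)
    (hP' : IsPartition P') (r : α) : RobberMove P r P' r := by
  obtain ⟨X, hX, hr⟩ := hP.cover r
  obtain ⟨X', hX', hr'⟩ := hP'.cover r
  exact robberMove_of_inter hP hP' hX hX' ⟨r, Finset.mem_inter.2 ⟨hr, hr'⟩⟩ hr hr'

/-- A monotone captain's move does not enlarge the robber space. -/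
theorem RobberMove.mem_of_isUnionOf {P P' : Finset (Finset α)} (hP : IsPartition P)
    {X : Finset α} (hX : X ∈ P) {r r' : α} (hr : r ∈ X) (hu : IsUnionOf X P')
    (h : RobberMove P r P' r') : r' ∈ X := by
  obtain ⟨X₁, hX₁, hr₁, Y, hY, hXY, hr'⟩ := h
  obtain rfl := hP.eq_of_mem hX hX₁ hr hr₁
  have hY' := mem_commonCoarsening.1 hY
  rwa [hY'.2.2 X hXY ⟨r, hr⟩ (isUnionOf_self hX) hu]

/-- `captainPlay` from an arbitrary initial partition. -/
def playFrom (P : Finset (Finset α)) (σ : List α → Finset (Finset α)) (r : ℕ → α) :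
    ℕ → Finset (Finset α)
  | 0 => P
  | n + 1 => σ ((List.range (n + 1)).map r)

theorem captainPlay_eq_playFrom (σ : List α → Finset (Finset α)) (r : ℕ → α) :
    captainPlay σ r = playFrom {Finset.univ} σ r := by
  funext n
  cases n <;> rfl

/-- The captain catches the robber by monotone moves from robber space `X`, within the set of
partitions `𝒬`. -/
inductive MonotoneCatch (𝒬 : Set (Finset (Finset α))) (𝒮 : Set (Finset α)) : Finset α → Prop
  | done {X : Finset α} : X ∈ 𝒮 → MonotoneCatch 𝒬 𝒮 X
  | step {X : Finset α} {P : Finset (Finset α)} : P ∈ 𝒬 → IsUnionOf X P →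
      (∀ Z ∈ P, Z ⊆ X → Z.Nonempty → MonotoneCatch 𝒬 𝒮 Z) → MonotoneCatch 𝒬 𝒮 X

variable {𝒬 : Set (Finset (Finset α))} {𝒮 : Set (Finset α)}

/-- The strategy `σ` catches by monotone moves a robber with space `X`. -/
def CatchesFrom (𝒬 : Set (Finset (Finset α))) (𝒮 : Set (Finset α)) (X : Finset α)
    (σ : List α → Finset (Finset α)) : Prop :=
  ∀ P ∈ 𝒬, X ∈ P → ∀ r : ℕ → α, r 0 ∈ X →
    (∀ n, RobberMove (playFrom P σ r n) (r n) (playFrom P σ r (n + 1)) (r (n + 1))) →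
    ∃ n, Caught 𝒮 (playFrom P σ r n) (r n) ∧
      ∀ m < n, MonotoneMove (playFrom P σ r m) (r m) (playFrom P σ r (m + 1))

/-- The strategy that first plays `P` and then follows `τ Z`, where `Z ∈ P` is the robber space. -/
def followUp (P : Finset (Finset α)) (cell : α → Finset α)
    (τ : Finset α → List α → Finset (Finset α)) : List α → Finset (Finset α)
  | _ :: a :: t => τ (cell a) (a :: t)
  | _ => P

theorem playFrom_followUp (P P' : Finset (Finset α)) (cell : α → Finset α)
    (τ : Finset α → List α → Finset (Finset α)) (r : ℕ → α) (n : ℕ) :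
    playFrom P (followUp P' cell τ) r (n + 1) =
      playFrom P' (τ (cell (r 1))) (fun i => r (i + 1)) n := by
  cases n with
  | zero => rfl
  | succ n =>
    simp only [playFrom]
    rw [List.range_succ_eq_map, List.range_succ_eq_map]
    simp [followUp, Function.comp_def]

/-- After the monotone move to `P'` the robber is still inside `X`, in a member of `P'` for which a
strategy is known; from then on that strategy is followed on the history with its first entry
removed. The capture time is `n + 1`, matching the rule that the captain wins only after a move. -/
theorem exists_catchesFrom_of_step (h𝒬 : ∀ P ∈ 𝒬, IsPartition P) {X : Finset α}
    {P' : Finset (Finset α)} (hP' : P' ∈ 𝒬) (hu : IsUnionOf X P')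
    (hZ : ∀ Z ∈ P', Z ⊆ X → Z.Nonempty → ∃ σ, (∀ h, σ h ∈ 𝒬) ∧ CatchesFrom 𝒬 𝒮 Z σ) :
    ∃ σ, (∀ h, σ h ∈ 𝒬) ∧ ∀ P ∈ 𝒬, X ∈ P → ∀ r : ℕ → α, r 0 ∈ X →
      (∀ n, RobberMove (playFrom P σ r n) (r n) (playFrom P σ r (n + 1)) (r (n + 1))) →
      ∃ n, Caught 𝒮 (playFrom P σ r (n + 1)) (r (n + 1)) ∧
        ∀ m ≤ n, MonotoneMove (playFrom P σ r m) (r m) (playFrom P σ r (m + 1)) := by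
  classical
  -- Sets that cannot be the next robber space get a constant strategy, so that the choice is total
  -- and stays in `𝒬`.
  have hex : ∀ Z, ∃ σ : List α → Finset (Finset α), (∀ h, σ h ∈ 𝒬) ∧
      (Z ∈ P' → Z ⊆ X → Z.Nonempty → CatchesFrom 𝒬 𝒮 Z σ) := by
    intro Z
    by_cases h : Z ∈ P' ∧ Z ⊆ X ∧ Z.Nonempty
    · obtain ⟨σ, h1, h2⟩ := hZ Z h.1 h.2.1 h.2.2
      exact ⟨σ, h1, fun _ _ _ => h2⟩
    · exact ⟨fun _ => P', fun _ => hP', fun h1 h2 h3 => absurd ⟨h1, h2, h3⟩ h⟩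
  choose τ hτ hτc using hex
  choose cell hcell hmem using (h𝒬 P' hP').cover
  refine ⟨followUp P' cell τ, ?_, ?_⟩
  · rintro (_ | ⟨a, _ | ⟨b, t⟩⟩)
    · exact hP'
    · exact hP'
    · exact hτ _ _
  · intro P hP hXP r hr hlegal
    have h0 := hlegal 0
    rw [playFrom_followUp] at h0
    have hr1 : r 1 ∈ X := RobberMove.mem_of_isUnionOf (h𝒬 P hP) hXP hr hu h0
    have hsub : cell (r 1) ⊆ X := hu.subset_of_mem (h𝒬 P' hP') (hcell _) (hmem _) hr1
    obtain ⟨n, hn, hmono⟩ := hτc (cell (r 1)) (hcell _) hsub ⟨_, hmem _⟩ P' hP' (hcell _)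
      (fun i => r (i + 1)) (hmem _) (fun n => by
        have := hlegal (n + 1)
        rwa [playFrom_followUp, playFrom_followUp] at this)
    refine ⟨n, by rwa [playFrom_followUp], fun m hm => ?_⟩
    cases m with
    | zero =>
      intro Z hZ hrZ
      obtain rfl := (h𝒬 P hP).eq_of_mem hXP hZ hr hrZ
      rwa [playFrom_followUp]
    | succ m =>
      rw [playFrom_followUp, playFrom_followUp]
      exact hmono m hm

theorem MonotoneCatch.exists_catchesFrom (h𝒬 : ∀ P ∈ 𝒬, IsPartition P)
    (huniv : {Finset.univ} ∈ 𝒬) {X : Finset α} (h : MonotoneCatch 𝒬 𝒮 X) :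
    ∃ σ, (∀ h, σ h ∈ 𝒬) ∧ CatchesFrom 𝒬 𝒮 X σ := by
  induction h with
  | @done X hX =>
    exact ⟨fun _ => {Finset.univ}, fun _ => huniv, fun P _ hXP r hr _ =>
      ⟨0, ⟨X, hXP, hr, hX⟩, fun m hm => absurd hm (by omega)⟩⟩
  | step hP hu _ ih =>
    obtain ⟨σ, h1, h2⟩ := exists_catchesFrom_of_step h𝒬 hP hu ih
    refine ⟨σ, h1, fun P hP hXP r hr hl => ?_⟩
    obtain ⟨n, hn, hm⟩ := h2 P hP hXP r hr hl
    exact ⟨n + 1, hn, fun m hm' => hm m (by omega)⟩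

theorem captainWinsMonotone_of_monotoneCatch [Nonempty α] (h𝒬 : ∀ P ∈ 𝒬, IsPartition P)
    (huniv : {Finset.univ} ∈ 𝒬) (h : MonotoneCatch 𝒬 𝒮 Finset.univ) :
    CaptainWinsMonotone 𝒬 𝒮 := by
  -- If `A` itself lies in `𝒮`, the captain must still make one move before she wins; she repeats
  -- `{A}`.
  have hstep : ∃ P ∈ 𝒬, IsUnionOf Finset.univ P ∧
      ∀ Z ∈ P, Z ⊆ Finset.univ → Z.Nonempty → MonotoneCatch 𝒬 𝒮 Z := by
    cases h with
    | done h =>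
      refine ⟨_, huniv, isUnionOf_self (by simp), fun Z hZ _ _ => ?_⟩
      rw [Finset.mem_singleton.1 hZ]
      exact .done h
    | step hP hu hZ => exact ⟨_, hP, hu, hZ⟩
  obtain ⟨P, hP, hu, hZ⟩ := hstep
  obtain ⟨σ, h1, h2⟩ := exists_catchesFrom_of_step h𝒬 hP hu fun Z h1 h2 h3 =>
    (hZ Z h1 h2 h3).exists_catchesFrom h𝒬 huniv
  refine ⟨huniv, σ, h1, fun r hr => ?_⟩
  rw [captainPlay_eq_playFrom]
  refine h2 _ huniv (by simp) r (by simp) fun n => ?_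
  rw [← captainPlay_eq_playFrom]
  exact hr n

theorem CaptainWinsMonotone.captainWins (h : CaptainWinsMonotone 𝒬 𝒮) : CaptainWins 𝒬 𝒮 := by
  obtain ⟨h0, σ, hσ, h⟩ := h
  refine ⟨h0, σ, hσ, fun r hr => ?_⟩
  obtain ⟨n, hn, -⟩ := h r hr
  exact ⟨n, hn⟩

theorem captainPlay_mem {σ : List α → Finset (Finset α)} (h0 : {Finset.univ} ∈ 𝒬)
    (hσ : ∀ h, σ h ∈ 𝒬) (r : ℕ → α) (n : ℕ) : captainPlay σ r n ∈ 𝒬 := by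
  cases n with
  | zero => exact h0
  | succ n => exact hσ _

/-- The robber escapes by sitting on a point outside `⋃ 𝒮`. -/
theorem CaptainWins.cover (h𝒬 : ∀ P ∈ 𝒬, IsPartition P) (h : CaptainWins 𝒬 𝒮) (a : α) :
    ∃ S ∈ 𝒮, a ∈ S := by
  obtain ⟨h0, σ, hσ, h⟩ := h
  obtain ⟨n, X, -, ha, hX⟩ := h (fun _ => a) fun n => robberMove_self
    (h𝒬 _ (captainPlay_mem h0 hσ _ _)) (h𝒬 _ (captainPlay_mem h0 hσ _ _)) a
  exact ⟨X, hX, ha⟩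

/-- The history of a robber who answers each partition `P` by moving to `g P`. -/
def answerHistory (σ : List α → Finset (Finset α)) (g : Finset (Finset α) → α) : ℕ → List α
  | 0 => []
  | n + 1 => answerHistory σ g n ++ [g (if n = 0 then {Finset.univ} else σ (answerHistory σ g n))]

/-- The robber's position depends on the captain's partition, which depends on his earlier positions
only; `answerHistory` resolves this recursion. -/
theorem exists_answering_play (σ : List α → Finset (Finset α)) (g : Finset (Finset α) → α) :
    ∃ r : ℕ → α, ∀ n, r n = g (captainPlay σ r n) := by
  let r : ℕ → α := fun n => g (if n = 0 then {Finset.univ} else σ (answerHistory σ g n))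
  have hr : ∀ n, (List.range n).map r = answerHistory σ g n := by
    intro n
    induction n with
    | zero => rfl
    | succ n ih => rw [List.range_succ, List.map_append, ih]; rfl
  refine ⟨r, fun n => ?_⟩
  cases n with
  | zero => rfl
  | succ n => simp only [captainPlay, hr]; rfl

theorem CaptainWins.not_hasBrambleAvoiding [Nonempty α] (h𝒬 : ∀ P ∈ 𝒬, IsPartition P)
    (h : CaptainWins 𝒬 𝒮) : ¬ HasBrambleAvoiding 𝒬 𝒮 := by
  classical
  rintro ⟨ℬ, hℬ, hdis⟩
  obtain ⟨h0, σ, hσ, h⟩ := h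
  have hg : ∀ P, ∃ a : α, P ∈ 𝒬 → ∃ X ∈ P, X ∈ ℬ ∧ a ∈ X := by
    intro P
    by_cases hP : P ∈ 𝒬
    · obtain ⟨X, hX, hXB⟩ := hℬ.meets P hP
      obtain ⟨a, ha⟩ := hℬ.members_nonempty X hXB
      exact ⟨a, fun _ => ⟨X, hX, hXB, ha⟩⟩
    · exact ⟨Classical.arbitrary α, fun h => absurd h hP⟩
  choose g hg using hg
  obtain ⟨r, hr⟩ := exists_answering_play σ g
  have hpos : ∀ n, ∃ X ∈ captainPlay σ r n, X ∈ ℬ ∧ r n ∈ X := by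
    intro n
    obtain ⟨X, hX, hXB, ha⟩ := hg _ (captainPlay_mem h0 hσ r n)
    exact ⟨X, hX, hXB, by rwa [hr n]⟩
  obtain ⟨n, Y, hY, hrY, hYS⟩ := h r fun n => by
    obtain ⟨X, hX, hXB, hrX⟩ := hpos n
    obtain ⟨X', hX', hXB', hrX'⟩ := hpos (n + 1)
    exact robberMove_of_inter (h𝒬 _ (captainPlay_mem h0 hσ _ _))
      (h𝒬 _ (captainPlay_mem h0 hσ _ _)) hX hX' (hℬ.intersecting X hXB X' hXB') hrX hrX'
  obtain ⟨X, hX, hXB, hrX⟩ := hpos (n + 1)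
  obtain rfl := (h𝒬 _ (captainPlay_mem h0 hσ r (n + 1))).eq_of_mem hX hY hrX hrY
  exact Set.disjoint_left.1 hdis hXB hYS

end GamePlay

end CaptainRobber

namespace CaptainRobber

/-! ### Sides of arcs in a tree -/

section Sides

variable {V : Type*} {T : SimpleGraph V}

/-- The nodes joined to `u` by a walk that avoids `t`. -/
def side (T : SimpleGraph V) (t u : V) : Set V :=
  {v | ∃ p : T.Walk u v, t ∉ p.support}

theorem self_mem_side {t u : V} (h : t ≠ u) : u ∈ side T t u :=
  ⟨.nil, by simpa using h⟩

theorem not_mem_side (t u : V) : t ∉ side T t u := by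
  rintro ⟨p, hp⟩
  exact hp p.end_mem_support

theorem eq_or_mem_side_of_mem_side {t u v : V} (h : v ∈ side T t u) :
    v = u ∨ ∃ w, T.Adj u w ∧ w ≠ t ∧ v ∈ side T u w := by
  classical
  obtain ⟨p, hp⟩ := h
  have hq : t ∉ p.bypass.support := fun h => hp (p.support_bypass_subset_support h)
  have hpath := p.bypass_isPath
  revert hq hpath
  generalize p.bypass = q
  intro hq hpath
  cases q with
  | nil => exact Or.inl rfl
  | @cons _ w _ h q =>
    rw [SimpleGraph.Walk.cons_isPath_iff] at hpath
    rw [SimpleGraph.Walk.support_cons, List.mem_cons, not_or] at hq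
    exact Or.inr ⟨w, h, fun h => hq.2 (h ▸ q.start_mem_support), q, hpath.2⟩

/-- If a walk from `w` avoiding `u` reached `t`, then going through `w` would give a second path
from `u` to its neighbour `t`. -/
theorem side_subset_side (hT : T.IsAcyclic) {t u w : V} (htu : T.Adj t u) (huw : T.Adj u w)
    (hwt : w ≠ t) : side T u w ⊆ side T t u := by
  classical
  rintro v ⟨p, hp⟩
  refine ⟨.cons huw p, ?_⟩
  rw [SimpleGraph.Walk.support_cons, List.mem_cons, not_or]
  refine ⟨htu.ne, fun ht => ?_⟩
  have hq : u ∉ (p.takeUntil t ht).bypass.support := fun h =>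
    hp (p.support_takeUntil_subset_support ht ((p.takeUntil t ht).support_bypass_subset_support h))
  have hpath : (SimpleGraph.Walk.cons huw (p.takeUntil t ht).bypass).IsPath :=
    (SimpleGraph.Walk.cons_isPath_iff _ _).2 ⟨SimpleGraph.Walk.bypass_isPath _, hq⟩
  have hpath' : (SimpleGraph.Walk.cons htu.symm SimpleGraph.Walk.nil).IsPath := by
    simp [htu.ne.symm]
  have heq := congrArg (fun q : T.Path u t => q.1.support)
    ((hT.subsingleton_path u t).elim ⟨_, hpath⟩ ⟨_, hpath'⟩)
  simp only [SimpleGraph.Walk.support_cons, SimpleGraph.Walk.support_nil, List.cons.injEq,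
    true_and] at heq
  have hw := (p.takeUntil t ht).bypass.start_mem_support
  rw [heq, List.mem_singleton] at hw
  exact hwt hw

theorem side_ssubset_side (hT : T.IsAcyclic) {t u w : V} (htu : T.Adj t u) (huw : T.Adj u w)
    (hwt : w ≠ t) : side T u w ⊂ side T t u :=
  ⟨side_subset_side hT htu huw hwt, fun h => not_mem_side u w (h (self_mem_side htu.ne))⟩

theorem mem_side_or_mem_side (hT : T.IsTree) {t u : V} (htu : T.Adj t u) (v : V) :
    v ∈ side T t u ∨ v ∈ side T u t := by
  by_cases hv : v = u
  · subst hv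
    exact Or.inl (self_mem_side htu.ne)
  · obtain ⟨p⟩ := hT.connected u v
    have hs : ∃ w, T.Adj u w ∧ v ∈ side T u w := by
      classical
      have hpath := p.bypass_isPath
      revert hpath
      generalize p.bypass = q
      intro hpath
      cases q with
      | nil => exact absurd rfl hv
      | @cons _ w _ h q => exact ⟨w, h, q, ((SimpleGraph.Walk.cons_isPath_iff _ _).1 hpath).2⟩
    obtain ⟨w, huw, hw⟩ := hs
    by_cases hwt : w = t
    · exact Or.inr (hwt ▸ hw)
    · exact Or.inl (side_subset_side hT.isAcyclic htu huw hwt hw)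

theorem side_eq_singleton {t u : V} (htu : T.Adj t u) (hu : IsLeafNode T u) :
    side T t u = {u} := by
  ext v
  constructor
  · intro hv
    rcases eq_or_mem_side_of_mem_side hv with rfl | ⟨w, huw, hwt, -⟩
    · rfl
    · exact absurd (hu huw htu.symm) hwt
  · rintro rfl
    exact self_mem_side htu.ne

/-- Induction on the arcs of a finite tree, from the leaves. -/
theorem arc_induction [Finite V] (hT : T.IsAcyclic) {p : V → V → Prop}
    (leaf : ∀ t u, T.Adj t u → IsLeafNode T u → p t u)
    (node : ∀ t u, T.Adj t u → ¬ IsLeafNode T u →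
      (∀ w, T.Adj u w → w ≠ t → p u w) → p t u) :
    ∀ t u, T.Adj t u → p t u := by
  have key : ∀ (s : Set V) t u, side T t u = s → T.Adj t u → p t u := by
    intro s
    induction s using WellFoundedLT.induction with
    | ind s ih =>
      rintro t u rfl htu
      by_cases hu : IsLeafNode T u
      · exact leaf t u htu hu
      · exact node t u htu hu fun w huw hwt =>
          ih _ (side_ssubset_side hT htu huw hwt) u w rfl huw
  exact fun t u => key _ t u rfl

theorem exists_adj_of_nontrivial (hT : T.IsTree) {t v : V} (h : v ≠ t) :
    ∃ u, T.Adj t u ∧ v ∈ side T t u := by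
  classical
  obtain ⟨p⟩ := hT.connected t v
  have hpath := p.bypass_isPath
  revert hpath
  generalize p.bypass = q
  intro hpath
  cases q with
  | nil => exact absurd rfl h
  | @cons _ w _ h q => exact ⟨w, h, q, ((SimpleGraph.Walk.cons_isPath_iff _ _).1 hpath).2⟩

/-- Translates components of `T ∖ t` into sides, which behave better under induction on arcs. -/
theorem mem_supp_induce_compl_iff {t u : V} (hu : u ∈ ({t}ᶜ : Set V)) (v : ({t}ᶜ : Set V)) :
    v ∈ ((T.induce ({t}ᶜ : Set V)).connectedComponentMk ⟨u, hu⟩).supp ↔ v.1 ∈ side T t u := by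
  rw [SimpleGraph.ConnectedComponent.mem_supp_iff, SimpleGraph.ConnectedComponent.eq]
  constructor
  · intro h
    obtain ⟨p⟩ := h.symm
    refine ⟨p.map (SimpleGraph.Embedding.induce _).toHom, fun h => ?_⟩
    obtain ⟨x, -, hx⟩ := List.mem_map.1 ((SimpleGraph.Walk.support_map _ p) ▸ h)
    exact x.2 hx
  · rintro ⟨p, hp⟩
    exact ⟨(p.induce ({t}ᶜ : Set V) fun x hx h => hp (h ▸ hx)).reverse⟩

end Sides

/-! ### Brambles against trees, and from search trees to tree decompositions -/

section TreeDecompositions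

variable {α : Type*} [Fintype α] [DecidableEq α] {V : Type*} {T : SimpleGraph V}
  {𝒬 : Set (Finset (Finset α))} {𝒮 : Set (Finset α)}

theorem mem_leafLabels {τ : V → Finset α} {X : Finset α} :
    X ∈ leafLabels T τ ↔ ∃ v, IsLeafNode T v ∧ τ v = X := by
  simp [leafLabels]

open Classical in
/-- The union of the labels of the leaves in `side T t u`. -/
noncomputable def sideLabel (T : SimpleGraph V) (τ : V → Finset α) (t u : V) : Finset α :=
  Finset.univ.filter fun a => ∃ v ∈ side T t u, IsLeafNode T v ∧ a ∈ τ v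

theorem mem_sideLabel {τ : V → Finset α} {t u : V} {a : α} :
    a ∈ sideLabel T τ t u ↔ ∃ v ∈ side T t u, IsLeafNode T v ∧ a ∈ τ v := by
  simp [sideLabel]

theorem mem_nodePartition (hT : T.IsTree) {τ : V → Finset α} {t : V} {X : Finset α} :
    X ∈ nodePartition T τ t ↔ ∃ u, T.Adj t u ∧ sideLabel T τ t u = X := by
  have key : ∀ u (hu : u ∈ ({t}ᶜ : Set V)), componentLabel T τ t
      ((T.induce ({t}ᶜ : Set V)).connectedComponentMk ⟨u, hu⟩) = sideLabel T τ t u := by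
    intro u hu
    ext a
    simp only [componentLabel, mem_sideLabel, Finset.mem_filter, Finset.mem_univ, true_and]
    constructor
    · rintro ⟨v, hv, h⟩
      exact ⟨v.1, (mem_supp_induce_compl_iff hu v).1 hv, h⟩
    · rintro ⟨v, hv, h⟩
      have hvt : v ≠ t := by
        rintro rfl
        exact not_mem_side _ _ hv
      exact ⟨⟨v, hvt⟩, (mem_supp_induce_compl_iff hu ⟨v, hvt⟩).2 hv, h⟩
  simp only [nodePartition, Finset.mem_filter, Finset.mem_univ, true_and]
  constructor
  · rintro ⟨C, rfl⟩
    obtain ⟨⟨v, hv⟩, rfl⟩ := C.exists_rep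
    obtain ⟨u, htu, hu⟩ := exists_adj_of_nontrivial hT hv
    refine ⟨u, htu, ?_⟩
    rw [← key u htu.ne.symm]
    congr 1
    exact ((mem_supp_induce_compl_iff htu.ne.symm ⟨v, hv⟩).2 hu).symm
  · rintro ⟨u, htu, rfl⟩
    exact ⟨_, key u htu.ne.symm⟩

theorem mem_sideLabel_of_not_leaf (hT : T.IsAcyclic) {τ : V → Finset α} {t u : V}
    (htu : T.Adj t u) (hu : ¬ IsLeafNode T u) {a : α} :
    a ∈ sideLabel T τ t u ↔ ∃ w, T.Adj u w ∧ w ≠ t ∧ a ∈ sideLabel T τ u w := by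
  simp only [mem_sideLabel]
  constructor
  · rintro ⟨v, hv, hl, ha⟩
    rcases eq_or_mem_side_of_mem_side hv with rfl | ⟨w, huw, hwt, hw⟩
    · exact absurd hl hu
    · exact ⟨w, huw, hwt, v, hw, hl, ha⟩
  · rintro ⟨w, huw, hwt, v, hv, h⟩
    exact ⟨v, side_subset_side hT htu huw hwt hv, h⟩

theorem sideLabel_of_leaf {τ : V → Finset α} {t u : V} (htu : T.Adj t u)
    (hu : IsLeafNode T u) : sideLabel T τ t u = τ u := by
  ext a
  rw [mem_sideLabel, side_eq_singleton htu hu]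
  simp [hu]

/-- Following the bramble away from `t` leads to a leaf. -/
theorem IsTreeDecomposition.not_subset_sideLabel [Finite V] {τ : V → Finset α}
    (h : IsTreeDecomposition 𝒬 𝒮 T τ) (h𝒬 : ∀ P ∈ 𝒬, IsPartition P)
    (h𝒮 : ∀ S ∈ 𝒮, ∀ S' ⊆ S, S' ∈ 𝒮) {ℬ : Set (Finset α)} (hℬ : IsBramble 𝒬 ℬ)
    (hdis : Disjoint ℬ 𝒮) : ∀ t u, T.Adj t u → ∀ B ∈ ℬ, ¬ B ⊆ sideLabel T τ t u := by
  have hac := h.isTree.isAcyclic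
  refine arc_induction (p := fun t u => ∀ B ∈ ℬ, ¬ B ⊆ sideLabel T τ t u) hac ?_ ?_
  · intro t u htu hu B hB hsub
    rw [sideLabel_of_leaf htu hu] at hsub
    exact Set.disjoint_left.1 hdis hB (h𝒮 _ (h.leaf_mem u hu) B hsub)
  · intro t u htu hu ih B hB hsub
    obtain ⟨B', hB', hB'B⟩ := hℬ.meets _ (h.td2 u hu)
    obtain ⟨a, ha⟩ := hℬ.intersecting B hB B' hB'B
    rw [Finset.mem_inter] at ha
    -- The common point `a` lies in a label pointing away from `t`. Members of a partition sharing a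
    -- point are equal, so `B'` is that label and the bramble points on to `w`.
    obtain ⟨w, huw, hwt, haw⟩ := (mem_sideLabel_of_not_leaf hac htu hu).1 (hsub ha.1)
    have heq := (h𝒬 _ (h.td2 u hu)).eq_of_mem ((mem_nodePartition h.isTree).2 ⟨w, huw, rfl⟩)
      hB' haw ha.2
    exact ih w huw hwt B' hB'B heq.ge

theorem IsScenario.univ_mem (hsc : IsScenario 𝒬 𝒮) {S : Finset α} (hS : S ∈ 𝒮) :
    {Finset.univ} ∈ 𝒬 := by
  refine hsc.sc1 _ (hsc.sc3 S hS) _ isPartition_univ fun X hX => ?_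
  rw [Finset.mem_singleton.1 hX]
  exact ⟨_, subset_rfl, by simp, by simp⟩

theorem HasTreeDecomposition.not_hasBrambleAvoiding [Nonempty α] (hsc : IsScenario 𝒬 𝒮)
    (h𝒮 : ∀ S ∈ 𝒮, ∀ S' ⊆ S, S' ∈ 𝒮) (h : HasTreeDecomposition 𝒬 𝒮) :
    ¬ HasBrambleAvoiding 𝒬 𝒮 := by
  rintro ⟨ℬ, hℬ, hdis⟩
  obtain ⟨V, _, T, τ, h⟩ := h
  have hcover : ∀ a : α, ∃ v, IsLeafNode T v ∧ a ∈ τ v := by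
    intro a
    obtain ⟨X, hX, ha⟩ := h.td1.cover a
    obtain ⟨v, hv, rfl⟩ := mem_leafLabels.1 hX
    exact ⟨v, hv, ha⟩
  have hno := h.not_subset_sideLabel hsc.isPartition h𝒮 hℬ hdis
  by_cases hedge : ∃ t u, T.Adj t u
  · obtain ⟨t, u, htu⟩ := hedge
    by_cases ht : IsLeafNode T t
    · obtain ⟨X, hX, hXB⟩ := hℬ.meets _ (hsc.sc3 _ (h.leaf_mem t ht))
      simp only [Finset.mem_insert, Finset.mem_singleton] at hX
      rcases hX with rfl | rfl
      · exact Set.disjoint_left.1 hdis hXB (h.leaf_mem t ht)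
      -- The far side of the leaf `t` contains `(τ t)ᶜ` but may be larger, since several leaves may
      -- share a label; hence the use of containment rather than equality.
      · refine hno t u htu _ hXB fun a ha => ?_
        obtain ⟨v, hv, hav⟩ := hcover a
        rw [mem_sideLabel]
        rcases mem_side_or_mem_side h.isTree htu v with hside | hside
        · exact ⟨v, hside, hv, hav⟩
        · rw [side_eq_singleton htu.symm ht] at hside
          obtain rfl := hside
          exact absurd hav (Finset.mem_compl.1 ha)
    · obtain ⟨X, hX, hXB⟩ := hℬ.meets _ (h.td2 t ht)
      obtain ⟨w, htw, rfl⟩ := (mem_nodePartition h.isTree).1 hX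
      exact hno t w htw _ hXB subset_rfl
  · push Not at hedge
    obtain ⟨t⟩ := h.isTree.connected.nonempty
    have hall : ∀ v, v = t := by
      intro v
      by_contra hv
      obtain ⟨u, htu, -⟩ := exists_adj_of_nontrivial h.isTree hv
      exact hedge t u htu
    have ht : IsLeafNode T t := fun a ha => absurd ha (hedge t a)
    have huniv : τ t = Finset.univ := by
      ext a
      obtain ⟨v, -, ha⟩ := hcover a
      simpa [hall v] using ha
    -- In a one-node tree the single label is `A`, so `𝒮` contains every set and nothing avoids it.
    have hS := h.leaf_mem t ht
    obtain ⟨B, hB⟩ := hℬ.nonempty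
    exact Set.disjoint_left.1 hdis hB (h𝒮 _ hS B (huniv ▸ Finset.subset_univ B))

theorem mem_outLabels {l : V → V → Finset α} {t : V} {X : Finset α} :
    X ∈ outLabels T l t ↔ ∃ u, T.Adj t u ∧ l t u = X := by
  simp [outLabels]

/-- No arc label lies in the bramble: otherwise the bramble member at the head of the arc labels an
onward arc, as the label of the reversed arc is disjoint from the given one, and this continues to a
leaf. But some label does: at an internal node by its partition, at a leaf by (SC3) and exactness.
-/
theorem HasExactSearchTree.not_hasBrambleAvoiding (hsc : IsScenario 𝒬 𝒮)
    (h : HasExactSearchTree 𝒬 𝒮) : ¬ HasBrambleAvoiding 𝒬 𝒮 := by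
  rintro ⟨ℬ, hℬ, hdis⟩
  obtain ⟨V, _, T, l, ⟨hst, hnode, hleaf⟩, hex⟩ := h
  have hno : ∀ t u, T.Adj t u → l t u ∉ ℬ := by
    refine arc_induction (p := fun t u => l t u ∉ ℬ) hst.isTree.isAcyclic ?_ ?_
    · intro t u htu hu hB
      exact Set.disjoint_left.1 hdis hB (hleaf t u htu hu)
    · intro t u htu hu ih hB
      obtain ⟨B, hB', hBB⟩ := hℬ.meets _ (hnode u hu)
      obtain ⟨w, huw, rfl⟩ := mem_outLabels.1 hB'
      refine ih w huw ?_ hBB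
      rintro rfl
      have h1 := hℬ.intersecting _ hB _ hBB
      rw [Finset.disjoint_iff_inter_eq_empty.1 (hst.st2 w u htu)] at h1
      simp at h1
  obtain ⟨s, t, hadj⟩ := hst.has_edge
  by_cases hs : IsLeafNode T s
  · obtain ⟨X, hX, hXB⟩ := hℬ.meets _ (hsc.sc3 _ (hleaf t s hadj.symm hs))
    have hc : (l t s)ᶜ = l s t := (IsCompl.of_eq
      (Finset.disjoint_iff_inter_eq_empty.1 (hst.st2 t s hadj.symm))
      (hex t s hadj.symm)).compl_eq
    simp only [Finset.mem_insert, Finset.mem_singleton, hc] at hX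
    rcases hX with rfl | rfl
    · exact hno t s hadj.symm hXB
    · exact hno s t hadj hXB
  · obtain ⟨X, hX, hXB⟩ := hℬ.meets _ (hnode s hs)
    obtain ⟨u, hsu, rfl⟩ := mem_outLabels.1 hX
    exact hno s u hsu hXB

/-- An exact search tree in which the labels of distinct arcs leaving a node are disjoint yields
a tree decomposition. -/
theorem IsSearchTreeFor.hasTreeDecomposition {V : Type} [Finite V] {T : SimpleGraph V}
    {l : V → V → Finset α} (h : IsSearchTreeFor 𝒬 𝒮 T l) (hex : IsExact T l)
    (hdis : ∀ t u w, T.Adj t u → T.Adj t w → u ≠ w → Disjoint (l t u) (l t w)) :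
    HasTreeDecomposition 𝒬 𝒮 := by
  obtain ⟨hst, hnode, hleaf⟩ := h
  have hac := hst.isTree.isAcyclic
  obtain ⟨s₀, t₀, hst₀⟩ := hst.has_edge
  have hnb : ∀ v, ∃ u, T.Adj u v := by
    intro v
    by_cases hv : s₀ = v
    · exact ⟨t₀, hv ▸ hst₀.symm⟩
    · obtain ⟨u, hu, -⟩ := exists_adj_of_nontrivial hst.isTree hv
      exact ⟨u, hu.symm⟩
  choose nb hnb using hnb
  -- At a leaf the neighbour is unique, so the arbitrary choice `nb` gives the label of its only
  -- entering arc.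
  let τ : V → Finset α := fun v => l (nb v) v
  have hτ : ∀ t u, T.Adj t u → IsLeafNode T u → τ u = l t u := by
    intro t u htu hu
    have : nb u = t := hu (hnb u).symm htu.symm
    simp only [τ, this]
  have hmem : ∀ t u, T.Adj t u → ∀ a, a ∈ l t u ↔ a ∉ l u t := by
    intro t u htu a
    have h1 : a ∈ l t u ∪ l u t := by rw [hex t u htu]; exact Finset.mem_univ a
    have h2 := fun h : a ∈ l t u => Finset.disjoint_left.1 (hst.st2 t u htu) h
    rw [Finset.mem_union] at h1
    tauto
  have hside : ∀ t u, T.Adj t u → sideLabel T τ t u = l t u := by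
    refine arc_induction (p := fun t u => sideLabel T τ t u = l t u) hac ?_ ?_
    · intro t u htu hu
      rw [sideLabel_of_leaf htu hu, hτ t u htu hu]
    · intro t u htu hu ih
      ext a
      rw [mem_sideLabel_of_not_leaf hac htu hu, hmem t u htu a]
      constructor
      · rintro ⟨w, huw, hwt, ha⟩
        rw [ih w huw hwt] at ha
        exact Finset.disjoint_left.1 (hdis u w t huw htu.symm hwt) ha
      · intro ha
        obtain ⟨X, hX, haX⟩ := (hst.st1 u hu).cover a
        obtain ⟨w, huw, rfl⟩ := mem_outLabels.1 hX
        have hwt : w ≠ t := by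
          rintro rfl
          exact ha haX
        exact ⟨w, huw, hwt, by rwa [ih w huw hwt]⟩
  have hle : ∀ t u v, T.Adj t u → v ∈ side T t u → IsLeafNode T v → τ v ⊆ l t u := by
    intro t u v htu hv hl a ha
    rw [← hside t u htu, mem_sideLabel]
    exact ⟨v, hv, hl, ha⟩
  have hdisj : ∀ t u, T.Adj t u → ∀ v ∈ side T t u, ∀ w ∈ side T t u, IsLeafNode T v →
      IsLeafNode T w → v ≠ w → Disjoint (τ v) (τ w) := by
    refine arc_induction (p := fun t u => ∀ v ∈ side T t u, ∀ w ∈ side T t u, IsLeafNode T v →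
      IsLeafNode T w → v ≠ w → Disjoint (τ v) (τ w)) hac ?_ ?_
    · intro t u htu hu v hv w hw _ _ hne
      rw [side_eq_singleton htu hu] at hv hw
      exact absurd (hv.trans hw.symm) hne
    · intro t u htu hu ih v hv w hw hlv hlw hne
      rcases eq_or_mem_side_of_mem_side hv with rfl | ⟨x, hux, hxt, hvx⟩
      · exact absurd hlv hu
      rcases eq_or_mem_side_of_mem_side hw with rfl | ⟨y, huy, hyt, hwy⟩
      · exact absurd hlw hu
      by_cases hxy : x = y
      · subst hxy
        exact ih x hux hxt v hvx w hwy hlv hlw hne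
      · exact (hdis u x y hux huy hxy).mono (hle u x v hux hvx hlv) (hle u y w huy hwy hlw)
  refine ⟨V, inferInstance, T, τ, hst.isTree, fun v hv => hleaf _ _ (hnb v) hv, ⟨?_, ?_⟩, ?_⟩
  · intro X hX Y hY hne
    obtain ⟨v, hv, rfl⟩ := mem_leafLabels.1 hX
    obtain ⟨w, hw, rfl⟩ := mem_leafLabels.1 hY
    have hvw : v ≠ w := fun h => hne (h ▸ rfl)
    rcases mem_side_or_mem_side hst.isTree hst₀ v with h1 | h1 <;>
      rcases mem_side_or_mem_side hst.isTree hst₀ w with h2 | h2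
    · exact hdisj _ _ hst₀ v h1 w h2 hv hw hvw
    · exact (hst.st2 _ _ hst₀).mono (hle _ _ v hst₀ h1 hv) (hle _ _ w hst₀.symm h2 hw)
    · exact (hst.st2 _ _ hst₀.symm).mono (hle _ _ v hst₀.symm h1 hv) (hle _ _ w hst₀ h2 hw)
    · exact hdisj _ _ hst₀.symm v h1 w h2 hv hw hvw
  · intro a
    have ha : a ∈ l s₀ t₀ ∪ l t₀ s₀ := by rw [hex s₀ t₀ hst₀]; exact Finset.mem_univ a
    rw [Finset.mem_union, ← hside _ _ hst₀, ← hside _ _ hst₀.symm, mem_sideLabel,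
      mem_sideLabel] at ha
    obtain ⟨v, -, hv, ha⟩ | ⟨v, -, hv, ha⟩ := ha
    all_goals exact ⟨τ v, mem_leafLabels.2 ⟨v, hv, rfl⟩, ha⟩
  · intro t ht
    have : nodePartition T τ t = outLabels T l t := by
      ext X
      rw [mem_nodePartition hst.isTree, mem_outLabels]
      constructor <;> rintro ⟨u, htu, rfl⟩ <;> exact ⟨u, htu, by rw [hside t u htu]⟩
    rw [this]
    exact hnode t ht

end TreeDecompositions

end CaptainRobber

namespace CaptainRobber

/-! ### Trees from parent functions -/

section ParentFunctions

variable {V : Type*}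

/-- A graph whose edges join the nodes other than the root to their parents is a tree. -/
theorem isTree_of_parent [Finite V] {G : SimpleGraph V} (up : V → V) (r : V) (d : V → ℕ)
    (hadj : ∀ v, v ≠ r → G.Adj v (up v)) (hd : ∀ v, v ≠ r → d (up v) < d v)
    (h : ∀ x y, G.Adj x y → (x ≠ r ∧ up x = y) ∨ (y ≠ r ∧ up y = x)) : G.IsTree := by
  classical
  have := Fintype.ofFinite V
  rw [SimpleGraph.isTree_iff_connected_and_card]
  constructor
  · have hreach : ∀ n v, d v = n → G.Reachable v r := by
      intro n
      induction n using Nat.strong_induction_on with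
      | _ n ih =>
        rintro v rfl
        by_cases hv : v = r
        · rw [hv]
        · exact (hadj v hv).reachable.trans (ih _ (hd v hv) _ rfl)
    have : Nonempty V := ⟨r⟩
    exact ⟨fun x y => (hreach _ x rfl).trans (hreach _ y rfl).symm⟩
  · let e : {v : V // v ≠ r} → G.edgeSet := fun v => ⟨s(v.1, up v.1), hadj v.1 v.2⟩
    have he : Function.Bijective e := by
      constructor
      · rintro ⟨x, hx⟩ ⟨y, hy⟩ hxy
        have hxy' : s(x, up x) = s(y, up y) := congrArg Subtype.val hxy
        rw [Sym2.eq_iff] at hxy'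
        rcases hxy' with ⟨h, -⟩ | ⟨h1, h2⟩
        · exact Subtype.ext h
        · have hx' := hd x hx
          have hy' := hd y hy
          rw [h2] at hx'
          rw [← h1] at hy'
          omega
      · rintro ⟨z, hz⟩
        induction z using Sym2.ind with
        | _ x y =>
          rcases h x y hz with ⟨hx, rfl⟩ | ⟨hy, rfl⟩
          · exact ⟨⟨x, hx⟩, rfl⟩
          · exact ⟨⟨y, hy⟩, Subtype.ext Sym2.eq_swap⟩
    rw [← Nat.card_congr (Equiv.ofBijective e he), Nat.card_eq_fintype_card,
      Nat.card_eq_fintype_card, Fintype.card_subtype_compl, Fintype.card_subtype_eq]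
    have : 0 < Fintype.card V := Fintype.card_pos_iff.2 ⟨r⟩
    omega

end ParentFunctions

/-! ### Rooted trees from fillings, and their union along a root edge -/

section PlantedTrees

variable {α : Type*} [Fintype α] [DecidableEq α]

/-- A rooted tree, given by a parent function, in which the label of a node stands for the arc
entering it from its parent. -/
structure PlantedTree (𝒬 : Set (Finset (Finset α))) (𝒮 : Set (Finset α)) (V : Type) where
  par : V → Option V
  depth : V → ℕ
  label : V → Finset α
  root : V
  par_eq_none : ∀ v, par v = none ↔ v = root
  depth_lt : ∀ v u, par v = some u → depth u < depth v
  -- At an internal node the children correspond one to one to the members of `P` other than `(label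
  -- v)ᶜ`. This rules out repeated labels, as the passage to a tree decomposition requires.
  leaf_or_node : ∀ v, ((∀ w, par w ≠ some v) ∧ label v ∈ 𝒮) ∨
    ((∃ w, par w = some v) ∧ ∃ P ∈ 𝒬,
      (∀ Z, Z ∈ P ↔ Z = (label v)ᶜ ∨ ∃ w, par w = some v ∧ label w = Z) ∧
      (∀ w, par w = some v → label w ≠ (label v)ᶜ) ∧
      ∀ w w', par w = some v → par w' = some v → label w = label w' → w = w')

variable {𝒬 : Set (Finset (Finset α))} {𝒮 : Set (Finset α)}

theorem exists_plantedTree_of_mem {X : Finset α} (hX : X ∈ 𝒮) :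
    ∃ (V : Type) (_ : Finite V) (t : PlantedTree 𝒬 𝒮 V), t.label t.root = X :=
  ⟨Unit, inferInstance, ⟨fun _ => none, fun _ => 0, fun _ => X, (), by simp, by simp,
    fun _ => Or.inl ⟨by simp, hX⟩⟩, rfl⟩

/-- A node with label `X` is put above the trees `t i`. -/
def PlantedTree.graft {ι : Type} {V : ι → Type} (t : ∀ i, PlantedTree 𝒬 𝒮 (V i)) (X : Finset α)
    [Nonempty ι] (P : Finset (Finset α)) (hP : P ∈ 𝒬)
    (hmem : ∀ Z, Z ∈ P ↔ Z = Xᶜ ∨ ∃ i, (t i).label (t i).root = Z)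
    (hne : ∀ i, (t i).label (t i).root ≠ Xᶜ)
    (hinj : ∀ i j, (t i).label (t i).root = (t j).label (t j).root → i = j) :
    PlantedTree 𝒬 𝒮 (Option (Σ i, V i)) where
  par
    | none => none
    | some ⟨i, v⟩ => some (((t i).par v).map (Sigma.mk i))
  depth
    | none => 0
    | some ⟨i, v⟩ => (t i).depth v + 1
  label
    | none => X
    | some ⟨i, v⟩ => (t i).label v
  root := none
  par_eq_none := by rintro (_ | ⟨i, v⟩) <;> simp
  depth_lt := by
    rintro (_ | ⟨i, v⟩) u hu
    · simp at hu
    · simp only [Option.some.injEq] at hu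
      subst hu
      cases hp : (t i).par v with
      | none => simp
      | some w => simpa using (t i).depth_lt v w hp
  leaf_or_node := by
    have hroot : ∀ i, ((t i).par (t i).root) = none := fun i => ((t i).par_eq_none _).2 rfl
    rintro (_ | ⟨i, v⟩)
    · right
      have hchild : ∀ i v, ((t i).par v).map (Sigma.mk (β := V) i) = none ↔ v = (t i).root := by
        intro i v
        rw [Option.map_eq_none_iff, (t i).par_eq_none]
      obtain ⟨i⟩ := ‹Nonempty ι›
      refine ⟨⟨some ⟨i, (t i).root⟩, by simp [hroot]⟩, P, hP, fun Z => ?_, ?_, ?_⟩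
      · rw [hmem]
        refine or_congr_right ⟨?_, ?_⟩
        · rintro ⟨i, hi⟩
          exact ⟨some ⟨i, (t i).root⟩, by simp [hroot], hi⟩
        · rintro ⟨_ | ⟨i, v⟩, h1, h2⟩
          · simp at h1
          · simp only [Option.some.injEq, hchild] at h1
            subst h1
            exact ⟨i, h2⟩
      · rintro (_ | ⟨i, v⟩) h1
        · simp at h1
        · simp only [Option.some.injEq, hchild] at h1
          subst h1
          exact hne i
      · rintro (_ | ⟨i, v⟩) (_ | ⟨j, w⟩) h1 h2 h3
        · rfl
        · simp at h1
        · simp at h2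
        · simp only [Option.some.injEq, hchild] at h1 h2
          subst h1 h2
          obtain rfl := hinj i j h3
          rfl
    · have hchild : ∀ j w, ((t j).par w).map (Sigma.mk (β := V) j) = some ⟨i, v⟩ ↔
          ∃ w', (t i).par w' = some v ∧ (⟨j, w⟩ : Σ i, V i) = ⟨i, w'⟩ := by
        intro j w
        rw [Option.map_eq_some_iff]
        constructor
        · rintro ⟨u, hu, huv⟩
          obtain rfl : j = i := congrArg Sigma.fst huv
          obtain rfl := eq_of_heq (Sigma.mk.inj huv).2
          exact ⟨w, hu, rfl⟩
        · rintro ⟨w', hw', h⟩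
          obtain rfl : j = i := congrArg Sigma.fst h
          obtain rfl := eq_of_heq (Sigma.mk.inj h).2
          exact ⟨v, hw', rfl⟩
      rcases (t i).leaf_or_node v with ⟨h1, h2⟩ | ⟨⟨w, hw⟩, R, hR, h1, h2, h3⟩
      · refine Or.inl ⟨?_, h2⟩
        rintro (_ | ⟨j, w⟩) h
        · simp at h
        · simp only [Option.some.injEq, hchild] at h
          obtain ⟨w', hw', -⟩ := h
          exact h1 w' hw'
      · refine Or.inr ⟨⟨some ⟨i, w⟩, by simp [hw]⟩, R, hR, fun Z => ?_, ?_, ?_⟩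
        · rw [h1]
          refine or_congr_right ⟨?_, ?_⟩
          · rintro ⟨w, hw, rfl⟩
            exact ⟨some ⟨i, w⟩, by simp [hw], rfl⟩
          · rintro ⟨_ | ⟨j, w⟩, h4, h5⟩
            · simp at h4
            · simp only [Option.some.injEq, hchild] at h4
              obtain ⟨w', hw', h⟩ := h4
              cases h
              exact ⟨w', hw', h5⟩
        · rintro (_ | ⟨j, w⟩) h4
          · simp at h4
          · simp only [Option.some.injEq, hchild] at h4
            obtain ⟨w', hw', h⟩ := h4
            cases h
            exact h2 w' hw'
        · rintro (_ | ⟨j, w⟩) (_ | ⟨j', w'⟩) h4 h5 h6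
          · rfl
          · simp at h4
          · simp at h5
          · simp only [Option.some.injEq, hchild] at h4 h5
            obtain ⟨x, hx, h⟩ := h4
            obtain ⟨y, hy, h'⟩ := h5
            cases h
            cases h'
            rw [h3 _ _ hx hy h6]

theorem Fillable.exists_plantedTree (h𝒬 : ∀ P ∈ 𝒬, IsPartition P) (hemp : ∅ ∈ 𝒮) {X : Finset α}
    (h : Fillable 𝒬 𝒮 X) :
    ∃ (V : Type) (_ : Finite V) (t : PlantedTree 𝒬 𝒮 V), t.label t.root = X := by
  induction h with
  | base hX => exact exists_plantedTree_of_mem hX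
  | @node X P hP hXP _ ih =>
    by_cases hne : (P.erase Xᶜ).Nonempty
    · let e := (P.erase Xᶜ).equivFin
      have hmem : ∀ i, (e.symm i).1 ∈ P ∧ (e.symm i).1 ≠ Xᶜ := fun i =>
        ⟨Finset.mem_of_mem_erase (e.symm i).2, Finset.ne_of_mem_erase (e.symm i).2⟩
      have hex := fun i => ih _ (hmem i).1 (hmem i).2
      choose V hV t ht using hex
      have : Nonempty (Fin (P.erase Xᶜ).card) := ⟨e ⟨_, hne.choose_spec⟩⟩
      refine ⟨_, inferInstance, PlantedTree.graft t X P hP (fun Z => ?_) (fun i => ?_)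
        (fun i j hij => ?_), rfl⟩
      · constructor
        · intro hZ
          by_cases hZX : Z = Xᶜ
          · exact Or.inl hZX
          · refine Or.inr ⟨e ⟨Z, Finset.mem_erase.2 ⟨hZX, hZ⟩⟩, ?_⟩
            rw [ht, Equiv.symm_apply_apply]
        · rintro (rfl | ⟨i, rfl⟩)
          · exact hXP
          · rw [ht]
            exact (hmem i).1
      · rw [ht]
        exact (hmem i).2
      · rw [ht, ht] at hij
        exact e.symm.injective (Subtype.ext hij)
    -- If `Xᶜ` is the only member of `P`, the node would have no children; but then `X = ∅` and a
    -- leaf does the job.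
    · have hX : X = ∅ := by
        have h1 := (h𝒬 P hP).sup_erase hXP
        rw [Finset.not_nonempty_iff_eq_empty.1 hne] at h1
        simpa using h1.symm
      exact exists_plantedTree_of_mem (hX ▸ hemp)

/-- The neighbourhood of a node `e v` of a graph into which a planted tree is embedded. -/
theorem PlantedTree.leaf_or_node_of_embedding {V W : Type} (t : PlantedTree 𝒬 𝒮 V)
    {G : SimpleGraph W} {l : W → W → Finset α} {e : V → W} {v : V} {u : W}
    (hadj : ∀ y, G.Adj (e v) y ↔ y = u ∨ ∃ w, t.par w = some v ∧ y = e w)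
    (hu : ∀ w, t.par w = some v → u ≠ e w) (hlu : l (e v) u = (t.label v)ᶜ)
    (hl : ∀ w, t.par w = some v → l (e v) (e w) = t.label w) :
    ((∀ y, G.Adj (e v) y → y = u) ∧ t.label v ∈ 𝒮) ∨
      (¬ IsLeafNode G (e v) ∧ outLabels G l (e v) ∈ 𝒬 ∧
        ∀ y z, G.Adj (e v) y → G.Adj (e v) z → l (e v) y = l (e v) z → y = z) := by
  rcases t.leaf_or_node v with ⟨h1, h2⟩ | ⟨⟨w, hw⟩, P, hP, h1, h2, h3⟩
  · left
    refine ⟨fun y hy => ?_, h2⟩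
    rcases (hadj y).1 hy with rfl | ⟨w, hw, -⟩
    · rfl
    · exact absurd hw (h1 w)
  · right
    refine ⟨fun hleaf => hu w hw (hleaf ((hadj _).2 (Or.inl rfl))
      ((hadj _).2 (Or.inr ⟨w, hw, rfl⟩))), ?_, ?_⟩
    · have : outLabels G l (e v) = P := by
        ext Z
        rw [mem_outLabels, h1]
        constructor
        · rintro ⟨y, hy, rfl⟩
          rcases (hadj y).1 hy with rfl | ⟨w, hw, rfl⟩
          · exact Or.inl hlu
          · exact Or.inr ⟨w, hw, (hl w hw).symm⟩
        · rintro (rfl | ⟨w, hw, rfl⟩)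
          · exact ⟨u, (hadj _).2 (Or.inl rfl), hlu⟩
          · exact ⟨e w, (hadj _).2 (Or.inr ⟨w, hw, rfl⟩), hl w hw⟩
      rwa [this]
    · intro y z hy hz hyz
      rcases (hadj y).1 hy with rfl | ⟨w, hw, rfl⟩ <;>
        rcases (hadj z).1 hz with rfl | ⟨w', hw', rfl⟩
      · rfl
      · rw [hlu, hl w' hw'] at hyz
        exact absurd hyz.symm (h2 w' hw')
      · rw [hlu, hl w hw] at hyz
        exact absurd hyz (h2 w hw)
      · rw [hl w hw, hl w' hw'] at hyz
        rw [h3 w w' hw hw' hyz]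

/-- Two planted trees with complementary root labels are joined by an edge between their roots. -/
theorem PlantedTree.exists_searchTree {V₁ V₂ : Type} [Finite V₁] [Finite V₂]
    (h𝒬 : ∀ P ∈ 𝒬, IsPartition P) (t₁ : PlantedTree 𝒬 𝒮 V₁) (t₂ : PlantedTree 𝒬 𝒮 V₂)
    (hc : t₂.label t₂.root = (t₁.label t₁.root)ᶜ) :
    ∃ (T : SimpleGraph (V₁ ⊕ V₂)) (l : V₁ ⊕ V₂ → V₁ ⊕ V₂ → Finset α),
      IsSearchTreeFor 𝒬 𝒮 T l ∧ IsExact T l ∧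
        ∀ t, ¬ IsLeafNode T t →
          ∀ u w, T.Adj t u → T.Adj t w → u ≠ w → Disjoint (l t u) (l t w) := by
  classical
  -- The two roots are made each other's parent, which treats both trees alike. For the tree
  -- property the root of `t₁` is the root, and `d` places all of `t₂` below it.
  let up : V₁ ⊕ V₂ → V₁ ⊕ V₂ := Sum.elim
    (fun v => (t₁.par v).elim (.inr t₂.root) .inl) (fun v => (t₂.par v).elim (.inl t₁.root) .inr)
  let lab : V₁ ⊕ V₂ → Finset α := Sum.elim t₁.label t₂.label
  let d : V₁ ⊕ V₂ → ℕ := Sum.elim t₁.depth fun v => t₁.depth t₁.root + 1 + t₂.depth v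
  have hup₁ : ∀ v, (t₁.par v = none ∧ v = t₁.root ∧ up (.inl v) = .inr t₂.root) ∨
      ∃ u, t₁.par v = some u ∧ up (.inl v) = .inl u := by
    intro v
    cases hv : t₁.par v with
    | none => exact Or.inl ⟨rfl, (t₁.par_eq_none v).1 hv, by simp [up, hv]⟩
    | some u => exact Or.inr ⟨u, rfl, by simp [up, hv]⟩
  have hup₂ : ∀ v, (t₂.par v = none ∧ v = t₂.root ∧ up (.inr v) = .inl t₁.root) ∨
      ∃ u, t₂.par v = some u ∧ up (.inr v) = .inr u := by
    intro v
    cases hv : t₂.par v with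
    | none => exact Or.inl ⟨rfl, (t₂.par_eq_none v).1 hv, by simp [up, hv]⟩
    | some u => exact Or.inr ⟨u, rfl, by simp [up, hv]⟩
  have hroot : up (.inl t₁.root) = .inr t₂.root := by
    simp [up, (t₁.par_eq_none t₁.root).2 rfl]
  have hroot' : up (.inr t₂.root) = .inl t₁.root := by
    simp [up, (t₂.par_eq_none t₂.root).2 rfl]
  have hd : ∀ x, x ≠ .inl t₁.root → d (up x) < d x := by
    rintro (v | v) hx
    · rcases hup₁ v with ⟨-, rfl, -⟩ | ⟨u, hu, h⟩
      · exact absurd rfl hx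
      · rw [h]
        exact t₁.depth_lt v u hu
    · rcases hup₂ v with ⟨-, rfl, h⟩ | ⟨u, hu, h⟩
      · rw [h]
        simp only [d, Sum.elim_inl, Sum.elim_inr]
        omega
      · rw [h]
        have := t₂.depth_lt v u hu
        simp only [d, Sum.elim_inr]
        omega
  have hcycle : ∀ x, up (up x) = x → x = .inl t₁.root ∨ x = .inr t₂.root := by
    intro x hx
    by_contra! h
    have h1 := hd x h.1
    by_cases h2 : up x = .inl t₁.root
    · rw [h2, hroot] at hx
      exact h.2 hx.symm
    · have h3 := hd _ h2
      rw [hx] at h3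
      omega
  have hcompl : ∀ x y, up x = y → up y = x → (lab x)ᶜ = lab y := by
    rintro x y rfl hx
    rcases hcycle x hx with rfl | rfl
    · rw [hroot]
      exact hc.symm
    · rw [hroot']
      simp only [lab, Sum.elim_inl, Sum.elim_inr, hc, compl_compl]
  have hne : ∀ x, up x ≠ x := by
    intro x hx
    by_cases h : x = .inl t₁.root
    · rw [h, hroot] at hx
      cases hx
    · have := hd x h
      rw [hx] at this
      omega
  let T : SimpleGraph (V₁ ⊕ V₂) :=
    { Adj := fun x y => up x = y ∨ up y = x
      symm := ⟨fun x y h => h.symm⟩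
      loopless := ⟨fun x h => h.elim (hne x) (hne x)⟩ }
  -- An arc to the parent gets the complement of the label of its tail, an arc to a child the label
  -- of its head. On the root edge both rules apply and agree, because the root labels are
  -- complementary.
  let l : V₁ ⊕ V₂ → V₁ ⊕ V₂ → Finset α := fun x y => if up x = y then (lab x)ᶜ else lab y
  have hlup : ∀ x, l x (up x) = (lab x)ᶜ := fun x => if_pos rfl
  have hldown : ∀ y, l (up y) y = lab y := by
    intro y
    by_cases h : up (up y) = y
    · simp only [l, if_pos h]
      exact hcompl _ _ h rfl
    · simp only [l, if_neg h]
  have hlcompl : ∀ x y, T.Adj x y → l x y = (l y x)ᶜ := by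
    rintro x y (rfl | rfl)
    · rw [hlup, hldown]
    · rw [hlup, hldown, compl_compl]
  have htree : T.IsTree := by
    refine isTree_of_parent up (.inl t₁.root) d (fun x _ => Or.inl rfl) hd ?_
    have key : ∀ x, (x ≠ Sum.inl t₁.root ∧ up x = up x) ∨
        (up x ≠ Sum.inl t₁.root ∧ up (up x) = x) := by
      intro x
      by_cases h : x = .inl t₁.root
      · rw [h, hroot, hroot']
        exact Or.inr ⟨by simp, rfl⟩
      · exact Or.inl ⟨h, rfl⟩
    rintro x y (rfl | rfl)
    · exact key x
    · exact (key y).symm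
  have hlocal : ∀ x, ((∀ y, T.Adj x y → y = up x) ∧ lab x ∈ 𝒮) ∨
      (¬ IsLeafNode T x ∧ outLabels T l x ∈ 𝒬 ∧
        ∀ y z, T.Adj x y → T.Adj x z → l x y = l x z → y = z) := by
    rintro (v | v)
    · have hchild : ∀ w, t₁.par w = some v → up (.inl w) = .inl v := fun w hw => by simp [up, hw]
      refine t₁.leaf_or_node_of_embedding (e := Sum.inl) (fun y => ?_) (fun w hw h => ?_)
        (hlup (.inl v)) fun w hw => ?_
      · constructor
        · rintro (h | h)
          · exact Or.inl h.symm
          · rcases y with w | w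
            · rcases hup₁ w with ⟨-, -, h'⟩ | ⟨u, hu, h'⟩
              · rw [h'] at h
                cases h
              · rw [h'] at h
                cases h
                exact Or.inr ⟨w, hu, rfl⟩
            · rcases hup₂ w with ⟨-, rfl, h'⟩ | ⟨u, hu, h'⟩
              · rw [h'] at h
                cases h
                exact Or.inl hroot.symm
              · rw [h'] at h
                cases h
        · rintro (rfl | ⟨w, hw, rfl⟩)
          · exact Or.inl rfl
          · exact Or.inr (hchild w hw)
      · have h1 := hchild w hw
        rw [← h] at h1
        rcases hcycle _ h1 with h2 | h2
        · cases h2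
          rw [hroot] at h
          cases h
        · cases h2
      · have := hldown (.inl w)
        rwa [hchild w hw] at this
    · have hchild : ∀ w, t₂.par w = some v → up (.inr w) = .inr v := fun w hw => by simp [up, hw]
      refine t₂.leaf_or_node_of_embedding (e := Sum.inr) (fun y => ?_) (fun w hw h => ?_)
        (hlup (.inr v)) fun w hw => ?_
      · constructor
        · rintro (h | h)
          · exact Or.inl h.symm
          · rcases y with w | w
            · rcases hup₁ w with ⟨-, rfl, h'⟩ | ⟨u, hu, h'⟩
              · rw [h'] at h
                cases h
                exact Or.inl hroot'.symm
              · rw [h'] at h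
                cases h
            · rcases hup₂ w with ⟨-, -, h'⟩ | ⟨u, hu, h'⟩
              · rw [h'] at h
                cases h
              · rw [h'] at h
                cases h
                exact Or.inr ⟨w, hu, rfl⟩
        · rintro (rfl | ⟨w, hw, rfl⟩)
          · exact Or.inl rfl
          · exact Or.inr (hchild w hw)
      · have h1 := hchild w hw
        rw [← h] at h1
        rcases hcycle _ h1 with h2 | h2
        · cases h2
        · cases h2
          rw [hroot'] at h
          cases h
      · have := hldown (.inr w)
        rwa [hchild w hw] at this
  have hnode : ∀ x, ¬ IsLeafNode T x → outLabels T l x ∈ 𝒬 ∧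
      ∀ y z, T.Adj x y → T.Adj x z → l x y = l x z → y = z := by
    intro x hx
    rcases hlocal x with ⟨h, -⟩ | ⟨-, h⟩
    · exact absurd (fun a ha b hb => (h a ha).trans (h b hb).symm) hx
    · exact h
  refine ⟨T, l, ⟨⟨htree, ⟨_, _, Or.inl hroot⟩, fun x hx => h𝒬 _ (hnode x hx).1, ?_⟩,
    fun x hx => (hnode x hx).1, ?_⟩, ?_, ?_⟩
  · intro x y h
    rw [hlcompl x y h]
    exact disjoint_compl_left
  · intro x y h hy
    rcases hlocal y with ⟨h1, h2⟩ | ⟨h1, -⟩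
    · rw [h1 x h.symm, hldown]
      exact h2
    · exact absurd hy h1
  · intro x y h
    rw [hlcompl x y h, Finset.union_comm]
    exact Finset.union_compl _
  · intro x hx y z hy hz hyz
    obtain ⟨h1, h2⟩ := hnode x hx
    exact (h𝒬 _ h1).disjoint _ (mem_outLabels.2 ⟨y, hy, rfl⟩) _ (mem_outLabels.2 ⟨z, hz, rfl⟩)
      fun h => hyz (h2 y z hy hz h)

end PlantedTrees

end CaptainRobber

namespace CaptainRobber

/-! ### From complementary fillings to strategies and trees -/

section Duality

variable {α : Type*} [Fintype α] [DecidableEq α] {𝒬 : Set (Finset (Finset α))}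
  {𝒮 : Set (Finset α)}

theorem isUnionOf_of_compl_mem {P : Finset (Finset α)} (hP : IsPartition P) {X : Finset α}
    (hX : X.Nonempty) (hXP : Xᶜ ∈ P) : IsUnionOf X P := by
  refine isUnionOf_of_saturated hP hX fun Z hZ a haZ haX b hb => ?_
  by_contra hbX
  have := hP.eq_of_mem hZ hXP hb (Finset.mem_compl.2 hbX)
  subst this
  exact Finset.mem_compl.1 haZ haX

/-- The partition at a node of the filling is itself the captain's move: `X` is the union of the
members other than `Xᶜ`, so the move is monotone and the robber ends up in one of the branches. -/
theorem Fillable.monotoneCatch (h𝒬 : ∀ P ∈ 𝒬, IsPartition P) (hemp : ∅ ∈ 𝒮) {X : Finset α}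
    (h : Fillable 𝒬 𝒮 X) : MonotoneCatch 𝒬 𝒮 X := by
  induction h with
  | base hX => exact .done hX
  | @node X P hP hXP _ ih =>
    rcases X.eq_empty_or_nonempty with rfl | hX
    · exact .done hemp
    · refine .step hP (isUnionOf_of_compl_mem (h𝒬 P hP) hX hXP) fun Z hZ hZX hne => ih Z hZ ?_
      rintro rfl
      obtain ⟨a, ha⟩ := hne
      exact Finset.mem_compl.1 ha (hZX ha)

theorem Fillable.pair_compl_mem (hsc : IsScenario 𝒬 𝒮) (hemp : ∅ ∈ 𝒮) {X : Finset α}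
    (h : Fillable 𝒬 𝒮 X) : {X, Xᶜ} ∈ 𝒬 := by
  cases h with
  | base hX => exact hsc.sc3 X hX
  | @node _ P hP hXP _ =>
    rcases X.eq_empty_or_nonempty with rfl | hX
    · exact hsc.sc3 _ hemp
    · refine hsc.sc1 P hP _ (isPartition_pair_compl X) fun Z hZ => ?_
      simp only [Finset.mem_insert, Finset.mem_singleton] at hZ
      rcases hZ with rfl | rfl
      · exact isUnionOf_of_compl_mem (hsc.isPartition P hP) hX hXP
      · exact isUnionOf_self hXP

theorem captainWinsMonotone_of_fillable [Nonempty α] (hsc : IsScenario 𝒬 𝒮) (hemp : ∅ ∈ 𝒮)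
    {U : Finset α} (hU : Fillable 𝒬 𝒮 U) (hUc : Fillable 𝒬 𝒮 Uᶜ) : CaptainWinsMonotone 𝒬 𝒮 := by
  refine captainWinsMonotone_of_monotoneCatch hsc.isPartition (hsc.univ_mem hemp)
    (.step (hU.pair_compl_mem hsc hemp) ?_ fun Z hZ _ _ => ?_)
  · exact ⟨{U, Uᶜ}, subset_rfl, by simp, by simp⟩
  · simp only [Finset.mem_insert, Finset.mem_singleton] at hZ
    rcases hZ with rfl | rfl
    · exact hU.monotoneCatch hsc.isPartition hemp
    · exact hUc.monotoneCatch hsc.isPartition hemp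

theorem exists_searchTree_of_fillable (h𝒬 : ∀ P ∈ 𝒬, IsPartition P) (hemp : ∅ ∈ 𝒮)
    {U : Finset α} (hU : Fillable 𝒬 𝒮 U) (hUc : Fillable 𝒬 𝒮 Uᶜ) :
    HasExactSearchTree 𝒬 𝒮 ∧ HasTreeDecomposition 𝒬 𝒮 := by
  obtain ⟨V₁, _, t₁, ht₁⟩ := hU.exists_plantedTree h𝒬 hemp
  obtain ⟨V₂, _, t₂, ht₂⟩ := hUc.exists_plantedTree h𝒬 hemp
  obtain ⟨T, l, h1, h2, h3⟩ := t₁.exists_searchTree h𝒬 t₂ (by rw [ht₁, ht₂])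
  refine ⟨⟨_, inferInstance, T, l, h1, h2⟩, h1.hasTreeDecomposition h2 fun t u w hu hw hne => ?_⟩
  by_cases ht : IsLeafNode T t
  · exact absurd (ht hu hw) hne
  · exact h3 t ht u w hu hw hne

end Duality

end CaptainRobber

open CaptainRobber
theorem mainTheorem7 {α : Type*} [Fintype α] [DecidableEq α] [Nonempty α]
    (f : Finset α → ℤ) (hf : IsConnectivityFunction f) (hf0 : 0 ≤ f ∅)
    (𝒮 : Set (Finset α)) (h𝒮 : ∀ S ∈ 𝒮, ∀ S' ⊆ S, S' ∈ 𝒮)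
    (k : ℤ) (hk : ∀ S ∈ 𝒮, 2 * f S ≤ k) :
    IsWeaklySubmodularScenario (partitionsOf f k) 𝒮 ∧
    ((∀ a : α, ∃ S ∈ 𝒮, a ∈ S) →
      List.TFAE
        [HasExactSearchTree (partitionsOf f k) 𝒮,
         HasTreeDecomposition (partitionsOf f k) 𝒮,
         CaptainWinsMonotone (partitionsOf f k) 𝒮,
         CaptainWins (partitionsOf f k) 𝒮,
         ¬ HasBrambleAvoiding (partitionsOf f k) 𝒮]) ∧
    IsMonotoneScenario (partitionsOf f k) 𝒮 := by
  have hsc := isScenario_partitionsOf hf hf0 h𝒮 hk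
  have hfill : (∀ a : α, ∃ S ∈ 𝒮, a ∈ S) → ¬ HasBrambleAvoiding (partitionsOf f k) 𝒮 →
      ∅ ∈ 𝒮 ∧ ∃ U, Fillable (partitionsOf f k) 𝒮 U ∧ Fillable (partitionsOf f k) 𝒮 Uᶜ := by
    intro hcov hB
    obtain ⟨S, hS, -⟩ := hcov (Classical.arbitrary α)
    have hemp := h𝒮 S hS ∅ (Finset.empty_subset S)
    exact ⟨hemp, exists_fillable_compl hf hf0 h𝒮 hemp hB⟩
  refine ⟨⟨hsc, weaklySubmodular_partitionsOf hf hf0 k⟩, fun hcov => ?_, fun h => ?_,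
    CaptainWinsMonotone.captainWins⟩
  · tfae_have 1 → 5 := HasExactSearchTree.not_hasBrambleAvoiding hsc
    tfae_have 2 → 5 := HasTreeDecomposition.not_hasBrambleAvoiding hsc h𝒮
    tfae_have 3 → 4 := CaptainWinsMonotone.captainWins
    tfae_have 4 → 5 := CaptainWins.not_hasBrambleAvoiding hsc.isPartition
    tfae_have 5 → 1 := fun hB => by
      obtain ⟨hemp, U, hU, hUc⟩ := hfill hcov hB
      exact (exists_searchTree_of_fillable hsc.isPartition hemp hU hUc).1
    tfae_have 5 → 2 := fun hB => by
      obtain ⟨hemp, U, hU, hUc⟩ := hfill hcov hB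
      exact (exists_searchTree_of_fillable hsc.isPartition hemp hU hUc).2
    tfae_have 5 → 3 := fun hB => by
      obtain ⟨hemp, U, hU, hUc⟩ := hfill hcov hB
      exact captainWinsMonotone_of_fillable hsc hemp hU hUc
    tfae_finish
  -- A captain's win itself yields the covering assumption, through a robber who stays put.
  · obtain ⟨hemp, U, hU, hUc⟩ := hfill (h.cover hsc.isPartition)
      (h.not_hasBrambleAvoiding hsc.isPartition)
    exact captainWinsMonotone_of_fillable hsc hemp hU hUc
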